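/- Let $D=\{z\in\mathbb{C}:|z|<1\}$, let $L^2(D)$ be taken with respect to Lebesgue area measure normalized so that $D$ has measure $1$, and let the Bergman space $L^2_a(D)\subset L^2(D)$ be the Hilbert space of square integrable holomorphic functions on $D$. For $\varphi\in L^\infty(D)$ let $T_\varphi:L^2_a(D)\to L^2_a(D)$, $T_\varphi u=P(\varphi u)$, be the Toeplitz operator with symbol $\varphi$, where $P$ is the orthogonal projection of $L^2(D)$ onto $L^2_a(D)$. Let the Toeplitz algebra be the $C^*$-algebra of bounded operators on $L^2_a(D)$ generated by all $T_\varphi$, $\varphi\in L^\infty(D)$. Let $f\in\mathbb{C}[z]$ be any nonconstant polynomial. If $S$ is an element of the Toeplitz algebra and $S$ commutes with $T_f$, then there is a bounded holomorphic function $g$ on $D$ such that $S=T_g$. -/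

import Mathlib

open MeasureTheory Filter Topology
open scoped ENNReal NNReal

noncomputable section

namespace Bergman

theorem circle_mean_le {g : ℂ → ℂ} {c : ℂ} {R r : ℝ} (hr : 0 < r) (hrR : r < R)
    (hg : DifferentiableOn ℂ g (Metric.ball c R)) :
    ENNReal.ofReal (2 * Real.pi) * ‖g c‖ₑ ≤
      ∫⁻ θ in Set.Ioo (-Real.pi) Real.pi, ‖g (c + Complex.polarCoord.symm (r, θ))‖ₑ := by
  have hd : DiffContOnCl ℂ g (Metric.ball c |r|) := by
    rw [abs_of_pos hr]
    refine DifferentiableOn.diffContOnCl (hg.mono ?_)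
    rw [closure_ball _ hr.ne']
    exact Metric.closedBall_subset_ball hrR
  have h1 := hd.circleAverage
  rw [Real.circleAverage_eq_integral_add (-Real.pi),
    intervalIntegral.integral_comp_add_right (fun θ => g (circleMap c r θ))] at h1
  have h2 : (∫ θ in (-Real.pi)..Real.pi, g (circleMap c r θ)) = (2 * Real.pi : ℝ) • g c := by
    rw [← h1, smul_smul, mul_inv_cancel₀ (by positivity), one_smul]
    congr 1 <;> ring
  rw [intervalIntegral.integral_of_le (by linarith [Real.pi_pos]),
    integral_Ioc_eq_integral_Ioo] at h2
  have h3 := enorm_integral_le_lintegral_enorm (μ := volume.restrict (Set.Ioo (-Real.pi) Real.pi))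
    (fun θ => g (circleMap c r θ))
  rw [h2, enorm_smul, Real.enorm_of_nonneg (by positivity)] at h3
  refine h3.trans (le_of_eq ?_)
  refine lintegral_congr fun θ => ?_
  rw [Complex.polarCoord_symm_apply, circleMap, Complex.exp_mul_I]
  push_cast
  rfl

/-- Area sub-mean value inequality for a holomorphic function. -/
theorem area_mean_le {g : ℂ → ℂ} {c : ℂ} {R : ℝ} (hR : 0 ≤ R)
    (hg : DifferentiableOn ℂ g (Metric.ball c R)) :
    ENNReal.ofReal (Real.pi * R ^ 2) * ‖g c‖ₑ ≤ ∫⁻ z in Metric.ball c R, ‖g z‖ₑ := by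
  classical
  set G : ℂ → ℂ := (Metric.ball c R).piecewise g 0 with hG
  have hGm : Measurable G :=
    ContinuousOn.measurable_piecewise hg.continuousOn continuousOn_const
      Metric.isOpen_ball.measurableSet
  have hGg : Set.EqOn G g (Metric.ball c R) := Set.piecewise_eqOn _ _ _
  have hGd : DifferentiableOn ℂ G (Metric.ball c R) := hg.congr hGg
  have e1 : ∫⁻ z in Metric.ball c R, ‖g z‖ₑ = ∫⁻ z, ‖G (c + z)‖ₑ := by
    rw [lintegral_add_left_eq_self (fun z => ‖G z‖ₑ) c,
      ← lintegral_indicator Metric.isOpen_ball.measurableSet]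
    refine lintegral_congr fun z => ?_
    by_cases hz : z ∈ Metric.ball c R
    · rw [Set.indicator_of_mem hz, hGg hz]
    · rw [Set.indicator_of_notMem hz, hG, Set.piecewise_eq_of_notMem _ _ _ hz]
      simp
  have hpm : Measurable fun p : ℝ × ℝ => Complex.polarCoord.symm p := by
    simp only [Complex.polarCoord_symm_apply]
    fun_prop
  rw [e1, ← Complex.lintegral_comp_polarCoord_symm, polarCoord_target,
    Measure.volume_eq_prod, ← Measure.prod_restrict, lintegral_prod _ (by
      refine Measurable.aemeasurable ?_
      simp only [smul_eq_mul]
      exact (by fun_prop : Measurable fun p : ℝ × ℝ => ENNReal.ofReal p.1).mul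
        (hGm.comp (hpm.const_add c)).enorm)]
  calc ENNReal.ofReal (Real.pi * R ^ 2) * ‖g c‖ₑ
      = ∫⁻ r in Set.Ioo 0 R, ENNReal.ofReal r * (ENNReal.ofReal (2 * Real.pi) * ‖g c‖ₑ) := by
        rw [lintegral_mul_const _ (by fun_prop), ← mul_assoc]
        congr 1
        have hi : IntegrableOn (fun r : ℝ => r) (Set.Ioo 0 R) :=
          (continuous_id.integrableOn_Icc (a := 0) (b := R)).mono_set Set.Ioo_subset_Icc_self
        rw [← ofReal_integral_eq_lintegral_ofReal hi ((ae_restrict_iff' measurableSet_Ioo).2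
          (Eventually.of_forall fun r hr => hr.1.le)), ← integral_Ioc_eq_integral_Ioo,
          ← intervalIntegral.integral_of_le hR, integral_id, ← ENNReal.ofReal_mul' (by positivity)]
        congr 1
        ring
    _ ≤ ∫⁻ r in Set.Ioo 0 R, ∫⁻ θ in Set.Ioo (-Real.pi) Real.pi,
          ENNReal.ofReal r • ‖G (c + Complex.polarCoord.symm (r, θ))‖ₑ := by
        refine setLIntegral_mono' measurableSet_Ioo fun r hr => ?_
        have hrR : c ∈ Metric.ball c R := Metric.mem_ball_self (hr.1.trans hr.2)
        simp only [smul_eq_mul]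
        rw [lintegral_const_mul' _ _ ENNReal.ofReal_ne_top, ← hGg hrR]
        gcongr
        exact circle_mean_le hr.1 hr.2 hGd
    _ ≤ _ := lintegral_mono_set Set.Ioo_subset_Ioi_self

/-- The open unit disk `D = {z : |z| < 1}`. -/
abbrev disk : Set ℂ := Metric.ball (0 : ℂ) 1

/-- Normalized area measure on the unit disk (total mass one). -/
def diskMeasure : Measure ℂ := (NNReal.pi : ℝ≥0∞)⁻¹ • (volume : Measure ℂ).restrict disk

theorem pi_ne_zero' : (NNReal.pi : ℝ≥0∞) ≠ 0 := by
  simpa using NNReal.pi_ne_zero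

instance : IsProbabilityMeasure diskMeasure := by
  constructor
  simp [diskMeasure, Complex.volume_ball, ENNReal.inv_mul_cancel pi_ne_zero' ENNReal.coe_ne_top]

theorem ae_diskMeasure_mem : ∀ᵐ z ∂diskMeasure, z ∈ disk := by
  refine Measure.ae_smul_measure ?_ _
  exact ae_restrict_mem Metric.isOpen_ball.measurableSet

theorem aestronglyMeasurable_of_holomorphic {g : ℂ → ℂ} (hg : DifferentiableOn ℂ g disk) :
    AEStronglyMeasurable g diskMeasure := by
  refine AEStronglyMeasurable.smul_measure ?_ _
  exact hg.continuousOn.aestronglyMeasurable Metric.isOpen_ball.measurableSet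

/-- Point evaluations are controlled by the `L²` norm, uniformly on smaller disks. -/
theorem enorm_apply_le {g : ℂ → ℂ} (hg : DifferentiableOn ℂ g disk) {z : ℂ} {δ : ℝ}
    (hδ : 0 < δ) (hz : Metric.ball z δ ⊆ disk) :
    ‖g z‖ₑ ≤ (ENNReal.ofReal (δ ^ 2))⁻¹ * eLpNorm g 2 diskMeasure := by
  have h1 := area_mean_le hδ.le (hg.mono hz)
  have h2 : ∫⁻ w in Metric.ball z δ, ‖g w‖ₑ ≤ NNReal.pi * eLpNorm g 1 diskMeasure := by
    rw [eLpNorm_one_eq_lintegral_enorm, diskMeasure, lintegral_smul_measure, smul_eq_mul,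
      ← mul_assoc, ENNReal.mul_inv_cancel pi_ne_zero' ENNReal.coe_ne_top, one_mul]
    exact lintegral_mono_set hz
  have h3 : eLpNorm g 1 diskMeasure ≤ eLpNorm g 2 diskMeasure :=
    eLpNorm_le_eLpNorm_of_exponent_le (by norm_num) (aestronglyMeasurable_of_holomorphic hg)
  have hp : ENNReal.ofReal Real.pi = NNReal.pi := by
    rw [← NNReal.coe_real_pi, ENNReal.ofReal_coe_nnreal]
  have h4 := h1.trans (h2.trans (mul_le_mul_right h3 _))
  rw [ENNReal.ofReal_mul Real.pi_pos.le, hp, mul_assoc,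
    ENNReal.mul_le_mul_iff_right pi_ne_zero' ENNReal.coe_ne_top] at h4
  rw [← ENNReal.div_eq_inv_mul, ENNReal.le_div_iff_mul_le (by simp [hδ.ne']) (by simp), mul_comm]
  exact h4

/-- The subspace of `L²(D)` formed by the classes in `L²(D)` that have a representative holomorphic
on the unit disk. -/
def bergmanSubmodule : Submodule ℂ (Lp ℂ 2 diskMeasure) where
  carrier := {F | ∃ g : ℂ → ℂ, DifferentiableOn ℂ g disk ∧ F =ᵐ[diskMeasure] g}
  add_mem' := by
    rintro F₁ F₂ ⟨g₁, h₁, e₁⟩ ⟨g₂, h₂, e₂⟩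
    exact ⟨g₁ + g₂, h₁.add h₂, (Lp.coeFn_add F₁ F₂).trans (e₁.add e₂)⟩
  zero_mem' := ⟨0, differentiableOn_const 0, Lp.coeFn_zero ℂ 2 diskMeasure⟩
  smul_mem' := by
    rintro a F ⟨g, h, e⟩
    exact ⟨a • g, h.const_smul a, (Lp.coeFn_smul a F).trans (e.const_smul a)⟩

theorem isClosed_bergmanSubmodule : IsClosed (bergmanSubmodule : Set (Lp ℂ 2 diskMeasure)) := by
  rw [← isSeqClosed_iff_isClosed]
  intro F F₀ hF hlim
  choose g hg hFg using hF
  have hest : ∀ m n (z : ℂ) (δ : ℝ), 0 < δ → Metric.ball z δ ⊆ disk →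
      edist (g m z) (g n z) ≤ (ENNReal.ofReal (δ ^ 2))⁻¹ * edist (F m) (F n) := by
    intro m n z δ hδ hz
    rw [Lp.edist_def, edist_eq_enorm_sub]
    refine (enorm_apply_le ((hg m).sub (hg n)) hδ hz).trans (le_of_eq ?_)
    congr 1
    exact eLpNorm_congr_ae ((hFg m).sub (hFg n)).symm
  have hest' : ∀ m n (z : ℂ) (δ : ℝ), 0 < δ → Metric.ball z δ ⊆ disk →
      dist (g m z) (g n z) ≤ (δ ^ 2)⁻¹ * dist (F m) (F n) := by
    intro m n z δ hδ hz
    have h := hest m n z δ hδ hz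
    rwa [edist_dist, edist_dist, ← ENNReal.ofReal_inv_of_pos (by positivity),
      ← ENNReal.ofReal_mul (by positivity), ENNReal.ofReal_le_ofReal_iff (by positivity)] at h
  have hcau : ∀ K ⊆ disk, IsCompact K → UniformCauchySeqOn g atTop K := by
    intro K hK hKc
    obtain ⟨δ, hδ, hKδ⟩ := hKc.exists_thickening_subset_open Metric.isOpen_ball hK
    rw [Metric.uniformCauchySeqOn_iff]
    intro ε hε
    obtain ⟨N, hN⟩ := Metric.cauchySeq_iff.1 hlim.cauchySeq (δ ^ 2 * ε) (by positivity)
    refine ⟨N, fun m hm n hn z hz => ?_⟩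
    have hb : Metric.ball z δ ⊆ disk := (Metric.ball_subset_thickening hz δ).trans hKδ
    refine (hest' m n z δ hδ hb).trans_lt ?_
    rw [inv_mul_lt_iff₀ (by positivity)]
    exact hN m hm n hn
  have hpt : ∀ z ∈ disk, ∃ w, Tendsto (fun n => g n z) atTop (𝓝 w) := by
    intro z hz
    exact cauchySeq_tendsto_of_complete
      ((hcau {z} (by simpa using hz) isCompact_singleton).cauchySeq rfl)
  choose! g₀ hg₀ using hpt
  have hloc : TendstoLocallyUniformlyOn g g₀ atTop disk :=
    (tendstoLocallyUniformlyOn_iff_forall_isCompact Metric.isOpen_ball).2 fun K hK hKc =>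
      (hcau K hK hKc).tendstoUniformlyOn_of_tendsto fun z hz => hg₀ z (hK hz)
  refine ⟨g₀, hloc.differentiableOn (Eventually.of_forall hg) Metric.isOpen_ball, ?_⟩
  obtain ⟨ns, hns, hae⟩ := (tendstoInMeasure_of_tendsto_Lp hlim).exists_seq_tendsto_ae
  filter_upwards [hae, ae_all_iff.2 hFg, ae_diskMeasure_mem] with z h1 h2 h3
  refine tendsto_nhds_unique h1 ?_
  simp only [h2]
  exact (hg₀ z h3).comp hns.tendsto_atTop

instance : CompleteSpace bergmanSubmodule := isClosed_bergmanSubmodule.completeSpace_coe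

/-- The Bergman space `L²_a(D)`, a Hilbert space with the inner product and norm of `L²(D)`. -/
def BergmanSpace : Type := bergmanSubmodule

instance : NormedAddCommGroup BergmanSpace := inferInstanceAs (NormedAddCommGroup bergmanSubmodule)

instance : InnerProductSpace ℂ BergmanSpace :=
  inferInstanceAs (InnerProductSpace ℂ bergmanSubmodule)

instance : CompleteSpace BergmanSpace := inferInstanceAs (CompleteSpace bergmanSubmodule)

/-- The inclusion of the Bergman space in `L²(D)`. -/
def incl : BergmanSpace →L[ℂ] Lp ℂ 2 diskMeasure := bergmanSubmodule.subtypeL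

/-- The orthogonal projection of `L²(D)` onto the Bergman space. -/
def proj : Lp ℂ 2 diskMeasure →L[ℂ] BergmanSpace := bergmanSubmodule.orthogonalProjectionOnto

/-- The operator on `L²(D)` of multiplication by `φ ∈ L^∞(D)`. -/
def mulOp (φ : Lp ℂ ∞ diskMeasure) : Lp ℂ 2 diskMeasure →L[ℂ] Lp ℂ 2 diskMeasure :=
  (ContinuousLinearMap.mul ℂ ℂ).holderL diskMeasure ∞ 2 2 φ

/-- The Toeplitz operator `T_φ u = P (φ u)` on the Bergman space with symbol `φ ∈ L^∞(D)`, where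
`P` is the orthogonal projection of `L²(D)` onto the Bergman space. -/
def toeplitz (φ : Lp ℂ ∞ diskMeasure) : BergmanSpace →L[ℂ] BergmanSpace :=
  proj ∘L mulOp φ ∘L incl

/-- The Toeplitz algebra: the C⋆-algebra generated by all Toeplitz operators with bounded symbol,
that is, the norm closure of the unital ⋆-algebra they generate (the identity is `T_1`). -/
def toeplitzAlgebra : StarSubalgebra ℂ (BergmanSpace →L[ℂ] BergmanSpace) :=
  (StarAlgebra.adjoin ℂ (Set.range toeplitz)).topologicalClosure

/-- `g ∈ H^∞(D)`: the function `g` is holomorphic and bounded on the unit disk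
(its values off the disk are irrelevant). -/
structure IsHInfty (g : ℂ → ℂ) : Prop where
  holomorphic : DifferentiableOn ℂ g disk
  bounded : ∃ C : ℝ, ∀ z ∈ disk, ‖g z‖ ≤ C

theorem IsHInfty.memLp {g : ℂ → ℂ} (hg : IsHInfty g) : MemLp g ∞ diskMeasure := by
  obtain ⟨C, hC⟩ := hg.bounded
  exact memLp_top_of_bound (aestronglyMeasurable_of_holomorphic hg.holomorphic) C
    (ae_diskMeasure_mem.mono hC)

/-- The class in `L^∞(D)` of a bounded holomorphic function on the disk. -/
def IsHInfty.symbol {g : ℂ → ℂ} (hg : IsHInfty g) : Lp ℂ ∞ diskMeasure := hg.memLp.toLp g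

theorem isHInfty_polynomial (f : Polynomial ℂ) : IsHInfty fun z => f.eval z := by
  refine ⟨f.differentiable.differentiableOn, ?_⟩
  obtain ⟨C, hC⟩ := (isCompact_closedBall (0 : ℂ) 1).exists_bound_of_continuousOn
    f.continuous.continuousOn
  exact ⟨C, fun z hz => hC z (Metric.ball_subset_closedBall hz)⟩

end Bergman

end

open MeasureTheory Filter Topology
open scoped ENNReal NNReal

noncomputable section

namespace Bergman

/-! Write `T_z` for `shift` and put `K = S T_z - T_z S`. It commutes with `T_f`, because `S` and
`T_z` do. Its adjoint is compact: the Hankel operator `u ↦ (1 - P)(conj z · u)` is compact, so every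
element of the Toeplitz algebra commutes with the adjoint of `T_z` modulo compacts
(`isCompactOperator_commutator_of_mem_toeplitzAlgebra`). Such a `K` must vanish
(`eq_zero_of_isCompactOperator_adjoint`), and an operator commuting with `T_z` is multiplication by
a bounded holomorphic function (`exists_eq_toeplitz_of_commute_shift`).

To see that `K = 0`, let `q_a(z) = (f(z) - f(a)) / (z - a)`. If `f(a) = f(w)` with `w` in the disk,
the functional `u ↦ K(q_a u)(w)` kills all multiples of `z - a`, because `K` commutes with `T_f`.
Hence it is zero when `|a| > 1`, and a multiple of evaluation at `a` when `|a| < 1`. Testing on the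
normalized reproducing kernel at `a` bounds the multiple by a constant times `(1 - |a|²) / (1 - |w|)
· ‖K* k_w‖`, where `k_w` represents `u ↦ (1 - |w|) u(w)`. The `k_w` tend weakly to zero at the
boundary, so `‖K* k_w‖` tends to zero.

Let `a = σ(w)` follow a branch of `f(a) = f(w)` near a point `w₀` of the circle at which circle
points sent by `f` outside `f(D)` accumulate. If `|σ| > 1` somewhere in the disk near `w₀`, the
identity theorem makes `K(q_a u)(w)` vanish along the branch. Otherwise `|σ| = 1` at those
accumulating points, hence on an arc by real analyticity, so `1 - |σ(w)| = O(1 - |w|)`. The multiple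
is then a holomorphic function tending to zero at an arc, so it vanishes (`eqOn_zero_of_boundary`).

Over a regular value there are `deg f` distinct branches, while `q_a` has degree less than `deg f`
in `a`. So all coefficients in `a` vanish, the top one being a nonzero constant times `K u(w)`. A
suitable `w₀` exists because the boundary of `f(D)` separates the plane and is therefore uncountable
(`not_countable_boundary`). -/

/-! ### Holomorphic representatives and multiplication operators. -/

/-- The holomorphic representative of an element of the Bergman space. -/
def rep (u : BergmanSpace) : ℂ → ℂ := u.2.choose

theorem differentiableOn_rep (u : BergmanSpace) : DifferentiableOn ℂ (rep u) disk :=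
  u.2.choose_spec.1

theorem incl_ae_eq_rep (u : BergmanSpace) : incl u =ᵐ[diskMeasure] rep u :=
  u.2.choose_spec.2

theorem ae_diskMeasure_iff {p : ℂ → Prop} :
    (∀ᵐ z ∂diskMeasure, p z) ↔ ∀ᵐ z ∂(volume.restrict disk), p z := by
  rw [diskMeasure, Measure.ae_ennreal_smul_measure_iff]
  simp

theorem eqOn_of_ae_eq {g h : ℂ → ℂ} (hg : DifferentiableOn ℂ g disk)
    (hh : DifferentiableOn ℂ h disk) (e : g =ᵐ[diskMeasure] h) : Set.EqOn g h disk :=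
  Measure.eqOn_open_of_ae_eq (ae_diskMeasure_iff.1 e) Metric.isOpen_ball hg.continuousOn
    hh.continuousOn

theorem rep_eqOn {u : BergmanSpace} {g : ℂ → ℂ} (hg : DifferentiableOn ℂ g disk)
    (e : incl u =ᵐ[diskMeasure] g) : Set.EqOn (rep u) g disk :=
  eqOn_of_ae_eq (differentiableOn_rep u) hg ((incl_ae_eq_rep u).symm.trans e)

theorem incl_injective : Function.Injective incl := Subtype.val_injective

theorem ae_eq_of_eqOn {g h : ℂ → ℂ} (e : Set.EqOn g h disk) : g =ᵐ[diskMeasure] h :=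
  ae_diskMeasure_mem.mono fun _ hz => e hz

theorem ext_rep {u v : BergmanSpace} (h : Set.EqOn (rep u) (rep v) disk) : u = v :=
  incl_injective <| Lp.ext <|
    (incl_ae_eq_rep u).trans ((ae_eq_of_eqOn h).trans (incl_ae_eq_rep v).symm)

theorem rep_add (u v : BergmanSpace) {z : ℂ} (hz : z ∈ disk) :
    rep (u + v) z = rep u z + rep v z := by
  refine rep_eqOn (g := rep u + rep v) ((differentiableOn_rep u).add (differentiableOn_rep v))
    ?_ hz
  rw [map_add]
  exact (Lp.coeFn_add _ _).trans ((incl_ae_eq_rep u).add (incl_ae_eq_rep v))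

theorem rep_smul (c : ℂ) (u : BergmanSpace) {z : ℂ} (hz : z ∈ disk) :
    rep (c • u) z = c * rep u z := by
  refine rep_eqOn (g := c • rep u) ((differentiableOn_rep u).const_smul c) ?_ hz
  rw [map_smul]
  exact (Lp.coeFn_smul _ _).trans ((incl_ae_eq_rep u).const_smul c)

/-- Evaluation at a point of the disk, as a linear functional on the Bergman space. -/
def evalₗ {w : ℂ} (hw : w ∈ disk) : BergmanSpace →ₗ[ℂ] ℂ where
  toFun u := rep u w
  map_add' u v := rep_add u v hw
  map_smul' c u := rep_smul c u hw

theorem rep_zero {z : ℂ} (hz : z ∈ disk) : rep 0 z = 0 := (evalₗ hz).map_zero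

theorem rep_sub (u v : BergmanSpace) {z : ℂ} (hz : z ∈ disk) :
    rep (u - v) z = rep u z - rep v z := (evalₗ hz).map_sub u v

theorem rep_sum {ι : Type*} (s : Finset ι) (u : ι → BergmanSpace) {z : ℂ} (hz : z ∈ disk) :
    rep (∑ i ∈ s, u i) z = ∑ i ∈ s, rep (u i) z := map_sum (evalₗ hz) u s

/-- The element of the Bergman space given by a square integrable holomorphic function. -/
def ofHol (g : ℂ → ℂ) (hg : DifferentiableOn ℂ g disk) (hm : MemLp g 2 diskMeasure) :
    BergmanSpace :=
  ⟨hm.toLp g, g, hg, hm.coeFn_toLp⟩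

theorem rep_ofHol {g : ℂ → ℂ} (hg : DifferentiableOn ℂ g disk) (hm : MemLp g 2 diskMeasure) :
    Set.EqOn (rep (ofHol g hg hm)) g disk :=
  rep_eqOn hg hm.coeFn_toLp

theorem memLp_rep (u : BergmanSpace) : MemLp (rep u) 2 diskMeasure :=
  (memLp_congr_ae (incl_ae_eq_rep u)).1 (Lp.memLp (incl u))

theorem enorm_eq_eLpNorm_rep (u : BergmanSpace) : ‖u‖ₑ = eLpNorm (rep u) 2 diskMeasure := by
  have h : ‖u‖ₑ = ‖incl u‖ₑ := rfl
  rw [h, Lp.enorm_def]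
  exact eLpNorm_congr_ae (incl_ae_eq_rep u)

theorem enorm_sq_eq_lintegral (u : BergmanSpace) :
    ‖u‖ₑ ^ 2 = ∫⁻ z, ‖rep u z‖ₑ ^ 2 ∂diskMeasure := by
  rw [enorm_eq_eLpNorm_rep, eLpNorm_eq_lintegral_rpow_enorm_toReal (by norm_num) (by norm_num),
    ← ENNReal.rpow_natCast, ← ENNReal.rpow_mul]
  simp

theorem norm_incl (u : BergmanSpace) : ‖incl u‖ = ‖u‖ := rfl

theorem adjoint_incl : ContinuousLinearMap.adjoint incl = proj :=
  bergmanSubmodule.adjoint_subtypeL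

theorem proj_incl (u : BergmanSpace) : proj (incl u) = u :=
  bergmanSubmodule.orthogonalProjectionOnto_mem_subspace_eq_self u

theorem mulOp_ae (φ : Lp ℂ ∞ diskMeasure) (F : Lp ℂ 2 diskMeasure) :
    mulOp φ F =ᵐ[diskMeasure] fun z => φ z * F z :=
  (ContinuousLinearMap.mul ℂ ℂ).coeFn_holder φ F

theorem mulOp_commute (φ ψ : Lp ℂ ∞ diskMeasure) : Commute (mulOp φ) (mulOp ψ) := by
  ext F
  change ⇑(mulOp φ (mulOp ψ F)) =ᵐ[diskMeasure] ⇑(mulOp ψ (mulOp φ F))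
  filter_upwards [mulOp_ae φ (mulOp ψ F), mulOp_ae ψ (mulOp φ F), mulOp_ae φ F, mulOp_ae ψ F]
    with z h1 h2 h3 h4
  rw [h1, h2, h3, h4]
  ring

theorem adjoint_mulOp {φ ψ : Lp ℂ ∞ diskMeasure}
    (h : ∀ᵐ z ∂diskMeasure, ψ z = starRingEnd ℂ (φ z)) :
    ContinuousLinearMap.adjoint (mulOp φ) = mulOp ψ := by
  symm
  rw [ContinuousLinearMap.eq_adjoint_iff]
  intro F G
  rw [L2.inner_def, L2.inner_def]
  refine integral_congr_ae ?_
  filter_upwards [h, mulOp_ae ψ F, mulOp_ae φ G] with z h1 h2 h3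
  rw [h2, h3, h1]
  simp only [RCLike.inner_apply, map_mul, Complex.conj_conj]
  ring

section HInfty

variable {g : ℂ → ℂ} (hg : IsHInfty g)
include hg

theorem IsHInfty.symbol_ae : hg.symbol =ᵐ[diskMeasure] g := hg.memLp.coeFn_toLp

theorem mulOp_symbol_incl (u : BergmanSpace) :
    mulOp hg.symbol (incl u) =ᵐ[diskMeasure] fun z => g z * rep u z := by
  filter_upwards [mulOp_ae hg.symbol (incl u), hg.symbol_ae, incl_ae_eq_rep u] with z h1 h2 h3
  rw [h1, h2, h3]

/-- The product of two holomorphic functions is holomorphic, so the projection does nothing. -/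
theorem incl_toeplitz_symbol (u : BergmanSpace) :
    incl (toeplitz hg.symbol u) = mulOp hg.symbol (incl u) := by
  have hm : mulOp hg.symbol (incl u) ∈ bergmanSubmodule :=
    ⟨_, hg.holomorphic.mul (differentiableOn_rep u), mulOp_symbol_incl hg u⟩
  exact congrArg Subtype.val
    (bergmanSubmodule.orthogonalProjectionOnto_mem_subspace_eq_self ⟨_, hm⟩)

theorem rep_toeplitz (u : BergmanSpace) {z : ℂ} (hz : z ∈ disk) :
    rep (toeplitz hg.symbol u) z = g z * rep u z :=
  rep_eqOn (hg.holomorphic.mul (differentiableOn_rep u))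
    (by rw [incl_toeplitz_symbol hg u]; exact mulOp_symbol_incl hg u) hz

end HInfty

/-! ### Point evaluations and kernels tending weakly to zero. -/

/-- The sub-mean value inequality applied to the square of the representative. Keeping the integral
local gives the decay at the boundary as well as the bound on evaluations. -/
theorem ofReal_sq_mul_enorm_rep_sq_le (u : BergmanSpace) {w : ℂ} {δ : ℝ} (hδ : 0 ≤ δ)
    (hw : Metric.ball w δ ⊆ disk) :
    ENNReal.ofReal (δ ^ 2) * ‖rep u w‖ₑ ^ 2 ≤
      ∫⁻ z in Metric.ball w δ, ‖rep u z‖ₑ ^ 2 ∂diskMeasure := by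
  have h := area_mean_le hδ (((differentiableOn_rep u).mono hw).pow 2)
  have hp : ENNReal.ofReal Real.pi = NNReal.pi := by
    rw [← NNReal.coe_real_pi, ENNReal.ofReal_coe_nnreal]
  rw [diskMeasure, Measure.restrict_smul, Measure.restrict_restrict Metric.isOpen_ball.measurableSet,
    Set.inter_eq_left.2 hw, lintegral_smul_measure, smul_eq_mul]
  simp only [Pi.pow_apply, enorm_pow] at h
  rw [ENNReal.ofReal_mul Real.pi_pos.le, hp, mul_assoc] at h
  calc ENNReal.ofReal (δ ^ 2) * ‖rep u w‖ₑ ^ 2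
      = (NNReal.pi : ℝ≥0∞)⁻¹ * (NNReal.pi * (ENNReal.ofReal (δ ^ 2) * ‖rep u w‖ₑ ^ 2)) := by
        rw [← mul_assoc, ENNReal.inv_mul_cancel pi_ne_zero' ENNReal.coe_ne_top, one_mul]
    _ ≤ _ := by gcongr

theorem ball_one_sub_norm_subset (w : ℂ) : Metric.ball w (1 - ‖w‖) ⊆ disk := by
  refine Metric.ball_subset_ball' ?_
  simp

theorem one_sub_norm_mul_norm_rep_le (u : BergmanSpace) {w : ℂ} (hw : w ∈ disk) :
    (1 - ‖w‖) * ‖rep u w‖ ≤ ‖u‖ := by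
  have h0 : 0 ≤ 1 - ‖w‖ := by
    have := mem_ball_zero_iff.1 hw
    linarith
  have h := (ofReal_sq_mul_enorm_rep_sq_le u h0 (ball_one_sub_norm_subset w)).trans
    (setLIntegral_le_lintegral _ _)
  rw [← enorm_sq_eq_lintegral, ← ofReal_norm, ← ofReal_norm,
    ← ENNReal.ofReal_pow (norm_nonneg _), ← ENNReal.ofReal_pow (norm_nonneg _),
    ← ENNReal.ofReal_mul (by positivity), ENNReal.ofReal_le_ofReal_iff (by positivity),
    ← mul_pow] at h
  exact (pow_le_pow_iff_left₀ (by positivity) (by positivity) two_ne_zero).1 h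

/-- The continuous functional `u ↦ (1 - |w|) u(w)`. -/
def evalL {w : ℂ} (hw : w ∈ disk) : BergmanSpace →L[ℂ] ℂ :=
  LinearMap.mkContinuous (((1 - ‖w‖ : ℝ) : ℂ) • evalₗ hw) 1 fun u => by
    have h0 : 0 ≤ 1 - ‖w‖ := by
      have := mem_ball_zero_iff.1 hw
      linarith
    have := one_sub_norm_mul_norm_rep_le u hw
    simp only [LinearMap.smul_apply, smul_eq_mul, norm_mul, Complex.norm_real, one_mul]
    rwa [Real.norm_of_nonneg h0]

/-- The element of the Bergman space representing the functional `u ↦ (1 - |w|) u(w)`. -/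
def kernel {w : ℂ} (hw : w ∈ disk) : BergmanSpace :=
  (InnerProductSpace.toDual ℂ BergmanSpace).symm (evalL hw)

theorem inner_kernel {w : ℂ} (hw : w ∈ disk) (u : BergmanSpace) :
    inner ℂ (kernel hw) u = ((1 - ‖w‖ : ℝ) : ℂ) * rep u w :=
  InnerProductSpace.toDual_symm_apply

theorem norm_kernel_le {w : ℂ} (hw : w ∈ disk) : ‖kernel hw‖ ≤ 1 := by
  rw [kernel, LinearIsometryEquiv.norm_map]
  exact LinearMap.mkContinuous_norm_le _ zero_le_one _

/-- Elements of the Bergman space grow slower than the norm of point evaluation. -/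
theorem exists_norm_inner_kernel_le (u : BergmanSpace) {ε : ℝ} (hε : 0 < ε) :
    ∃ ρ < 1, ∀ w (hw : w ∈ disk), ρ < ‖w‖ → ‖inner ℂ (kernel hw) u‖ ≤ ε := by
  have hfin : ∫⁻ z, ‖rep u z‖ₑ ^ 2 ∂diskMeasure ≠ ∞ := by
    rw [← enorm_sq_eq_lintegral]
    simp
  have hs : ∀ n : ℕ, MeasurableSet {z : ℂ | 1 - ((n : ℝ) + 1)⁻¹ < ‖z‖} := fun n =>
    (isOpen_lt continuous_const continuous_norm).measurableSet
  have hlim : Tendsto (fun n : ℕ => diskMeasure {z : ℂ | 1 - ((n : ℝ) + 1)⁻¹ < ‖z‖}) atTop (𝓝 0) := by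
    have h := tendsto_measure_iInter_atTop (μ := diskMeasure)
      (fun n => (hs n).nullMeasurableSet) (fun m n hmn z hz => ?_) ⟨0, measure_ne_top _ _⟩
    · have h0 : diskMeasure (⋂ n : ℕ, {z : ℂ | 1 - ((n : ℝ) + 1)⁻¹ < ‖z‖}) = 0 := by
        refine measure_eq_zero_iff_ae_notMem.2 ?_
        filter_upwards [ae_diskMeasure_mem] with z hz hz'
        have hz1 := mem_ball_zero_iff.1 hz
        obtain ⟨n, hn⟩ := exists_nat_one_div_lt (sub_pos.2 hz1)
        have := Set.mem_iInter.1 hz' n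
        simp only [Set.mem_ofPred_eq] at this
        rw [one_div] at hn
        linarith
      rwa [h0] at h
    · simp only [Set.mem_ofPred_eq] at hz ⊢
      refine lt_of_le_of_lt ?_ hz
      gcongr
  have hint := tendsto_setLIntegral_zero hfin hlim
  have hε' : (0 : ℝ≥0∞) < ENNReal.ofReal (ε ^ 2) := ENNReal.ofReal_pos.2 (by positivity)
  obtain ⟨n, hn⟩ := ((hint.eventually (ge_mem_nhds hε')).and (eventually_ge_atTop 0)).exists
  -- The ball of radius `1 - ‖w‖` about `w` reaches inward to norm `2‖w‖ - 1`, hence the factor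
  -- `1/2`.
  refine ⟨1 - ((n : ℝ) + 1)⁻¹ / 2, by simp; positivity, fun w hw hρ => ?_⟩
  have h0 : 0 ≤ 1 - ‖w‖ := by
    have := mem_ball_zero_iff.1 hw
    linarith
  have h := ofReal_sq_mul_enorm_rep_sq_le u h0 (ball_one_sub_norm_subset w)
  have hsub : Metric.ball w (1 - ‖w‖) ⊆ {z : ℂ | 1 - ((n : ℝ) + 1)⁻¹ < ‖z‖} := by
    intro z hz
    have h1 := mem_ball_iff_norm'.1 hz
    have h2 := norm_sub_norm_le w z
    simp only [Set.mem_ofPred_eq]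
    linarith
  have h' := (h.trans (lintegral_mono_set hsub)).trans hn.1
  rw [← ofReal_norm, ← ENNReal.ofReal_pow (norm_nonneg _),
    ← ENNReal.ofReal_mul (by positivity), ENNReal.ofReal_le_ofReal_iff (by positivity),
    ← mul_pow] at h'
  rw [inner_kernel, norm_mul, Complex.norm_real, Real.norm_of_nonneg h0]
  exact (pow_le_pow_iff_left₀ (by positivity) hε.le two_ne_zero).1 h'

/-- A compact operator maps the normalized kernels to vectors tending to zero at the boundary. -/
theorem exists_norm_compact_kernel_le {L : BergmanSpace →L[ℂ] BergmanSpace}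
    (hL : IsCompactOperator L) {ε : ℝ} (hε : 0 < ε) :
    ∃ ρ < 1, ∀ w (hw : w ∈ disk), ρ < ‖w‖ → ‖L (kernel hw)‖ ≤ ε := by
  -- For `y` in a finite `η`-net, `‖L k‖² = ⟪L k, L k - y⟫ + ⟪L k, y⟫`; the terms are at most `‖L‖
  -- η` and, by weak convergence against the adjoint applied to `y`, `η`.
  obtain ⟨η, hη, hηε⟩ : ∃ η > 0, (‖L‖ + 1) * η ≤ ε ^ 2 :=
    ⟨ε ^ 2 / (‖L‖ + 1), by positivity, by field_simp; rfl⟩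
  have hc := IsCompactOperator.isCompact_closure_image_closedBall hL (f := L.toLinearMap) 1
  obtain ⟨t, ht, hcov⟩ := Metric.totallyBounded_iff.1 hc.totallyBounded η hη
  have hex : ∀ y : BergmanSpace, ∃ ρ < 1, ∀ w (hw : w ∈ disk), ρ < ‖w‖ →
      ‖inner ℂ (kernel hw) (ContinuousLinearMap.adjoint L y)‖ ≤ η :=
    fun y => exists_norm_inner_kernel_le _ hη
  choose ρ hρ1 hρ using hex
  obtain ⟨r, hr1, hr⟩ : ∃ r < 1, ∀ y ∈ t, ρ y ≤ r := by
    rcases t.eq_empty_or_nonempty with rfl | hne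
    · exact ⟨0, zero_lt_one, by simp⟩
    · obtain ⟨y, hy, hmax⟩ := ht.exists_maximalFor ρ t hne
      exact ⟨ρ y, hρ1 y, fun x hx => (le_total (ρ x) (ρ y)).elim id fun h => hmax hx h⟩
  refine ⟨r, hr1, fun w hw hrw => ?_⟩
  have hmem : L (kernel hw) ∈ closure (L.toLinearMap '' Metric.closedBall 0 1) :=
    subset_closure ⟨_, mem_closedBall_zero_iff.2 (norm_kernel_le hw), rfl⟩
  obtain ⟨y, hy, hyη⟩ := Set.mem_iUnion₂.1 (hcov hmem)
  have h1 : ‖inner ℂ (L (kernel hw)) y‖ ≤ η := by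
    rw [← ContinuousLinearMap.adjoint_inner_right]
    exact hρ y w hw ((hr y hy).trans_lt hrw)
  have h2 : ‖inner ℂ (L (kernel hw)) (L (kernel hw) - y)‖ ≤ ‖L‖ * η := by
    refine (norm_inner_le_norm _ _).trans ?_
    gcongr
    · simpa using L.le_of_opNorm_le_of_le le_rfl (norm_kernel_le hw)
    · exact (mem_ball_iff_norm.1 hyη).le
  have h3 : ‖L (kernel hw)‖ ^ 2 ≤ ε ^ 2 := by
    have h4 : (inner ℂ (L (kernel hw)) (L (kernel hw)) : ℂ) =
        inner ℂ (L (kernel hw)) (L (kernel hw) - y) + inner ℂ (L (kernel hw)) y := by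
      rw [← inner_add_right, sub_add_cancel]
    have h5 : ‖(inner ℂ (L (kernel hw)) (L (kernel hw)) : ℂ)‖ = ‖L (kernel hw)‖ ^ 2 := by
      rw [inner_self_eq_norm_sq_to_K]
      simp
    rw [← h5, h4]
    refine (norm_add_le _ _).trans ?_
    linarith
  exact (pow_le_pow_iff_left₀ (norm_nonneg _) hε.le two_ne_zero).1 h3

/-! ### The shift, difference quotients and the backward shift. -/

/-- The constant function one. -/
def one : BergmanSpace := ofHol 1 (differentiableOn_const 1) (memLp_const 1)

theorem rep_one {z : ℂ} (hz : z ∈ disk) : rep one z = 1 :=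
  rep_ofHol (differentiableOn_const 1) (memLp_const 1) hz

/-- Multiplication by the coordinate function. -/
def shift : BergmanSpace →L[ℂ] BergmanSpace :=
  toeplitz (isHInfty_polynomial Polynomial.X).symbol

theorem rep_shift (u : BergmanSpace) {z : ℂ} (hz : z ∈ disk) : rep (shift u) z = z * rep u z := by
  rw [shift, rep_toeplitz _ _ hz, Polynomial.eval_X]

theorem differentiableOn_dslope_rep (u : BergmanSpace) {a : ℂ} (ha : a ∈ disk) :
    DifferentiableOn ℂ (dslope (rep u) a) disk :=
  (Complex.differentiableOn_dslope (Metric.isOpen_ball.mem_nhds ha)).2 (differentiableOn_rep u)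

/-- Near `a` the difference quotient is continuous, hence bounded; elsewhere its denominator is at
least `δ`. -/
theorem memLp_dslope_rep (u : BergmanSpace) {a : ℂ} (ha : a ∈ disk) :
    MemLp (dslope (rep u) a) 2 diskMeasure := by
  obtain ⟨δ, hδ, hsub⟩ := Metric.nhds_basis_closedBall.mem_iff.1 (Metric.isOpen_ball.mem_nhds ha)
  obtain ⟨C, hC⟩ := (isCompact_closedBall a δ).exists_bound_of_continuousOn
    ((differentiableOn_dslope_rep u ha).continuousOn.mono hsub)
  have hm : MemLp (fun z => C + δ⁻¹ * (‖rep u z‖ + ‖rep u a‖)) 2 diskMeasure :=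
    (memLp_const C).add (((memLp_rep u).norm.add (memLp_const _)).const_mul δ⁻¹)
  refine hm.mono (aestronglyMeasurable_of_holomorphic (differentiableOn_dslope_rep u ha)) ?_
  have hC0 : 0 ≤ C := (norm_nonneg _).trans (hC a (Metric.mem_closedBall_self hδ.le))
  refine Eventually.of_forall fun z => ?_
  rw [Real.norm_of_nonneg (by positivity)]
  by_cases hz : z ∈ Metric.closedBall a δ
  · have := hC z hz
    have h2 : 0 ≤ δ⁻¹ * (‖rep u z‖ + ‖rep u a‖) := by positivity
    linarith
  · rw [Metric.mem_closedBall, not_le, dist_eq_norm] at hz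
    have hza : z ≠ a := by
      rintro rfl
      simp at hz
      linarith
    rw [dslope_of_ne _ hza, slope_def_module, norm_smul, norm_inv]
    have h1 : ‖z - a‖⁻¹ * ‖rep u z - rep u a‖ ≤ δ⁻¹ * (‖rep u z‖ + ‖rep u a‖) := by
      gcongr
      exact norm_sub_le _ _
    linarith

/-- The difference quotient `(u - u(a)) / (z - a)`. -/
def quot (u : BergmanSpace) {a : ℂ} (ha : a ∈ disk) : BergmanSpace :=
  ofHol _ (differentiableOn_dslope_rep u ha) (memLp_dslope_rep u ha)

theorem rep_quot (u : BergmanSpace) {a z : ℂ} (ha : a ∈ disk) (hz : z ∈ disk) :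
    (z - a) * rep (quot u ha) z = rep u z - rep u a := by
  rw [quot, rep_ofHol _ _ hz]
  exact sub_smul_dslope (rep u) a z

theorem shift_sub_quot (u : BergmanSpace) {a : ℂ} (ha : a ∈ disk) :
    shift (quot u ha) - a • quot u ha = u - rep u a • one := by
  refine ext_rep fun z hz => ?_
  rw [rep_sub _ _ hz, rep_shift _ hz, rep_smul _ _ hz, rep_sub _ _ hz, rep_smul _ _ hz,
    rep_one hz, ← sub_mul, rep_quot u ha hz, mul_one]

theorem shift_injective : Function.Injective shift := by
  refine (injective_iff_map_eq_zero shift).2 fun v hv => ext_rep ?_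
  refine eqOn_of_ae_eq (differentiableOn_rep v) (differentiableOn_rep 0) ?_
  have h0 : ∀ᵐ z ∂diskMeasure, z ≠ 0 := by
    rw [ae_diskMeasure_iff]
    exact ae_restrict_of_ae (Measure.ae_ne volume 0)
  filter_upwards [h0, ae_diskMeasure_mem] with z hz hzd
  have h := rep_shift v hzd
  rw [hv, rep_zero hzd, zero_eq_mul] at h
  rw [rep_zero hzd, h.resolve_left hz]

theorem zero_mem_disk : (0 : ℂ) ∈ disk := Metric.mem_ball_self one_pos

theorem shift_quot_zero (u : BergmanSpace) :
    shift (quot u zero_mem_disk) = u - rep u 0 • one := by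
  simpa using shift_sub_quot u zero_mem_disk

/-- The backward shift `u ↦ (u - u(0)) / z` as a linear map. -/
def backwardShiftₗ : BergmanSpace →ₗ[ℂ] BergmanSpace where
  toFun u := quot u zero_mem_disk
  map_add' u v := by
    refine shift_injective ?_
    rw [map_add, shift_quot_zero, shift_quot_zero, shift_quot_zero, rep_add _ _ zero_mem_disk,
      add_smul]
    abel
  map_smul' c u := by
    refine shift_injective ?_
    rw [map_smul, shift_quot_zero, shift_quot_zero, rep_smul _ _ zero_mem_disk, smul_sub,
      mul_smul, RingHom.id_apply]

theorem continuous_rep_zero : Continuous fun u : BergmanSpace => rep u 0 := by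
  have h := (evalL zero_mem_disk).continuous
  refine h.congr fun u => ?_
  simp [evalL, evalₗ]

/-- The backward shift `u ↦ (u - u(0)) / z`. -/
def backwardShift : BergmanSpace →L[ℂ] BergmanSpace where
  toLinearMap := backwardShiftₗ
  cont := by
    -- In the closed graph theorem the limit can be identified after applying the injective shift,
    -- where only evaluation at zero has to be continuous.
    refine LinearMap.continuous_of_seq_closed_graph _ fun u x y hu hy => shift_injective ?_
    have h1 := (shift.continuous.tendsto y).comp hy
    have h2 : Tendsto (fun n => u n - rep (u n) 0 • one) atTop (𝓝 (x - rep x 0 • one)) :=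
      hu.sub (((continuous_rep_zero.tendsto x).comp hu).smul_const one)
    refine (tendsto_nhds_unique h1 (h2.congr fun n => ?_)).trans (shift_quot_zero x).symm
    exact (shift_quot_zero (u n)).symm

theorem shift_backwardShift (u : BergmanSpace) :
    shift (backwardShift u) = u - rep u 0 • one := shift_quot_zero u

/-! ### Disk automorphisms and normalized reproducing kernels. -/

theorem abs_det_restrictScalars (c : ℂ) :
    |((ContinuousLinearMap.toSpanSingleton ℂ c).restrictScalars ℝ).det| = ‖c‖ ^ 2 := by
  have h : ((ContinuousLinearMap.toSpanSingleton ℂ c).restrictScalars ℝ : ℂ →L[ℝ] ℂ).toLinearMap =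
      (LinearMap.mulLeft ℝ c) := by
    ext
    simp [mul_comm]
  have h2 : ((ContinuousLinearMap.toSpanSingleton ℂ c).restrictScalars ℝ : ℂ →L[ℝ] ℂ).det =
      ‖c‖ ^ 2 := by
    rw [ContinuousLinearMap.det, h, ← LinearMap.det_toMatrix Complex.basisOneI, Matrix.det_fin_two]
    simp only [LinearMap.toMatrix_apply, Complex.coe_basisOneI, Complex.coe_basisOneI_repr]
    simp [Complex.sq_norm, Complex.normSq_apply]
  rw [h2, abs_of_nonneg (sq_nonneg _)]

theorem one_sub_conj_mul_ne_zero {a z : ℂ} (ha : a ∈ disk) (hz : z ∈ disk) :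
    1 - starRingEnd ℂ a * z ≠ 0 := by
  intro h
  have h1 : starRingEnd ℂ a * z = 1 := (sub_eq_zero.1 h).symm
  have h2 := congrArg norm h1
  rw [norm_mul, RCLike.norm_conj, norm_one] at h2
  nlinarith [mem_ball_zero_iff.1 ha, mem_ball_zero_iff.1 hz, norm_nonneg a, norm_nonneg z]

theorem hasDerivAt_moebius {a z : ℂ} (ha : a ∈ disk) (hz : z ∈ disk) :
    HasDerivAt (fun z => (z - a) / (1 - starRingEnd ℂ a * z))
      ((1 - starRingEnd ℂ a * a) / (1 - starRingEnd ℂ a * z) ^ 2) z := by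
  have h := ((hasDerivAt_id z).sub_const a).div
    (((hasDerivAt_id z).const_mul (starRingEnd ℂ a)).const_sub 1) (one_sub_conj_mul_ne_zero ha hz)
  refine h.congr_deriv ?_
  simp only [id]
  ring

theorem injOn_moebius {a : ℂ} (ha : a ∈ disk) :
    Set.InjOn (fun z => (z - a) / (1 - starRingEnd ℂ a * z)) disk := by
  intro z hz w hw h
  simp only at h
  rw [div_eq_div_iff (one_sub_conj_mul_ne_zero ha hz) (one_sub_conj_mul_ne_zero ha hw)] at h
  have h1 : (z - w) * (1 - starRingEnd ℂ a * a) = 0 := by linear_combination h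
  exact sub_eq_zero.1 ((mul_eq_zero.1 h1).resolve_right (one_sub_conj_mul_ne_zero ha ha))

theorem mapsTo_moebius {a : ℂ} (ha : a ∈ disk) :
    Set.MapsTo (fun z => (z - a) / (1 - starRingEnd ℂ a * z)) disk disk := by
  intro z hz
  have h1 := one_sub_conj_mul_ne_zero ha hz
  rw [mem_ball_zero_iff, norm_div, div_lt_one (norm_pos_iff.2 h1),
    ← pow_lt_pow_iff_left₀ (norm_nonneg _) (norm_nonneg _) two_ne_zero, Complex.sq_norm,
    Complex.sq_norm]
  have ha2 : Complex.normSq a < 1 := by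
    rw [← Complex.sq_norm]
    nlinarith [mem_ball_zero_iff.1 ha, norm_nonneg a]
  have hz2 : Complex.normSq z < 1 := by
    rw [← Complex.sq_norm]
    nlinarith [mem_ball_zero_iff.1 hz, norm_nonneg z]
  simp only [Complex.normSq_apply, Complex.sub_re, Complex.sub_im, Complex.mul_re, Complex.mul_im,
    Complex.conj_re, Complex.conj_im, Complex.one_re, Complex.one_im] at ha2 hz2 ⊢
  nlinarith [mul_pos (sub_pos.2 ha2) (sub_pos.2 hz2)]

/-- The derivative of a disk automorphism has norm at most one in the Bergman space: its squared
norm is the normalized area of the image of the disk. -/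
theorem eLpNorm_deriv_moebius_le {a : ℂ} (ha : a ∈ disk) :
    eLpNorm (fun z => (1 - starRingEnd ℂ a * a) / (1 - starRingEnd ℂ a * z) ^ 2) 2 diskMeasure
      ≤ 1 := by
  have h := lintegral_image_eq_lintegral_abs_det_fderiv_mul volume
    Metric.isOpen_ball.measurableSet
    (fun z hz => ((hasDerivAt_moebius ha hz).hasFDerivAt.restrictScalars ℝ).hasFDerivWithinAt
      (s := disk)) (injOn_moebius ha) (fun _ => 1)
  simp only [abs_det_restrictScalars, mul_one, lintegral_const, one_mul, Measure.restrict_apply,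
    MeasurableSet.univ, Set.univ_inter] at h
  have h2 := h.symm.le.trans (measure_mono (mapsTo_moebius ha).image_subset)
  have h3 : ∫⁻ z, ‖(1 - starRingEnd ℂ a * a) / (1 - starRingEnd ℂ a * z) ^ 2‖ₑ ^ 2 ∂diskMeasure
      ≤ 1 := by
    rw [← measure_univ (μ := diskMeasure)]
    simp only [diskMeasure, lintegral_smul_measure, Measure.smul_apply, smul_eq_mul,
      Measure.restrict_apply_univ]
    gcongr
    refine le_trans (le_of_eq (lintegral_congr fun z => ?_)) h2
    rw [← ofReal_norm, ENNReal.ofReal_pow (norm_nonneg _)]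
  rw [eLpNorm_eq_lintegral_rpow_enorm_toReal (by norm_num) (by norm_num)]
  refine ENNReal.rpow_le_one ?_ (by positivity)
  simpa using h3

theorem differentiableOn_deriv_moebius {a : ℂ} (ha : a ∈ disk) :
    DifferentiableOn ℂ (fun z => (1 - starRingEnd ℂ a * a) / (1 - starRingEnd ℂ a * z) ^ 2)
      disk :=
  (differentiableOn_const _).div (by fun_prop) fun z hz =>
    pow_ne_zero 2 (one_sub_conj_mul_ne_zero ha hz)

theorem memLp_deriv_moebius {a : ℂ} (ha : a ∈ disk) :
    MemLp (fun z => (1 - starRingEnd ℂ a * a) / (1 - starRingEnd ℂ a * z) ^ 2) 2 diskMeasure :=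
  ⟨aestronglyMeasurable_of_holomorphic (differentiableOn_deriv_moebius ha),
    (eLpNorm_deriv_moebius_le ha).trans_lt ENNReal.one_lt_top⟩

/-- The normalized reproducing kernel at a point of the disk. -/
def peak {a : ℂ} (ha : a ∈ disk) : BergmanSpace :=
  ofHol _ (differentiableOn_deriv_moebius ha) (memLp_deriv_moebius ha)

theorem norm_peak_le {a : ℂ} (ha : a ∈ disk) : ‖peak ha‖ ≤ 1 := by
  have h : ‖peak ha‖ₑ ≤ 1 := by
    rw [enorm_eq_eLpNorm_rep, peak, eLpNorm_congr_ae (ae_eq_of_eqOn (rep_ofHol _ _))]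
    exact eLpNorm_deriv_moebius_le ha
  rwa [← ofReal_norm, ENNReal.ofReal_le_one] at h

/-- These are the test functions: norm at most one, with the value at `a` as large as `1 / (1 -
‖a‖²)`. -/
theorem norm_rep_peak {a : ℂ} (ha : a ∈ disk) : (1 - ‖a‖ ^ 2) * ‖rep (peak ha) a‖ = 1 := by
  have h0 := one_sub_conj_mul_ne_zero ha ha
  have h1 : (1 - starRingEnd ℂ a * a) = ((1 - ‖a‖ ^ 2 : ℝ) : ℂ) := by
    rw [Complex.conj_mul']
    push_cast
    rfl
  have h2 : 0 < 1 - ‖a‖ ^ 2 := by nlinarith [mem_ball_zero_iff.1 ha, norm_nonneg a]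
  rw [peak, rep_ofHol _ _ ha]
  simp only [h1, norm_div, norm_pow, Complex.norm_real, Real.norm_of_nonneg h2.le]
  field_simp

/-! ### Compactness of multiplication by functions vanishing at the boundary. -/

section CompactOperator

variable {E F : Type*} [NormedAddCommGroup E] [NormedSpace ℂ E] [NormedAddCommGroup F]
  [NormedSpace ℂ F]

theorem isCompactOperator_of_eq {S T : E →L[ℂ] F} (hS : IsCompactOperator S) (h : T = S) :
    IsCompactOperator T := h ▸ hS

theorem isCompactOperator_add_of_eq {R S T : E →L[ℂ] F} (hR : IsCompactOperator R)
    (hS : IsCompactOperator S) (h : T = R + S) : IsCompactOperator T :=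
  isCompactOperator_of_eq (S := R + S) (hR.add hS) h

end CompactOperator

theorem norm_mulOp_le {φ : Lp ℂ ∞ diskMeasure} {C : ℝ} (hC : 0 ≤ C)
    (h : ∀ᵐ z ∂diskMeasure, ‖φ z‖ ≤ C) : ‖mulOp φ‖ ≤ C := by
  refine ContinuousLinearMap.opNorm_le_bound _ hC fun F => Lp.norm_le_mul_norm_of_ae_le_mul ?_
  filter_upwards [h, mulOp_ae φ F] with z h1 h2
  rw [h2, norm_mul]
  gcongr

theorem norm_mulOp_incl_le {φ : Lp ℂ ∞ diskMeasure} {r : ℝ}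
    (hφ : ∀ᵐ z ∂diskMeasure, r < ‖z‖ → φ z = 0) {u : BergmanSpace} {C : ℝ} (hC : 0 ≤ C)
    (hu : ∀ z ∈ disk, ‖z‖ ≤ r → ‖rep u z‖ ≤ C) : ‖mulOp φ (incl u)‖ ≤ ‖φ‖ * C := by
  have h : ‖mulOp φ (incl u)‖ ≤
      (measureUnivNNReal diskMeasure : ℝ) ^ (ENNReal.toReal 2)⁻¹ * (‖φ‖ * C) := by
    refine Lp.norm_le_of_ae_bound (by positivity) ?_
    have hb : ∀ᵐ z ∂diskMeasure, ‖φ z‖ ≤ ‖φ‖ := by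
      have := ae_le_eLpNormEssSup (f := φ) (μ := diskMeasure)
      filter_upwards [this] with z hz
      rw [Lp.norm_def, eLpNorm_exponent_top, ← toReal_enorm]
      refine ENNReal.toReal_mono ?_ hz
      rw [← eLpNorm_exponent_top]
      exact Lp.eLpNorm_ne_top φ
    filter_upwards [hφ, mulOp_ae φ (incl u), incl_ae_eq_rep u, hb, ae_diskMeasure_mem]
      with z h1 h2 h3 h4 h5
    rw [h2, norm_mul, h3]
    rcases le_or_gt ‖z‖ r with hz | hz
    · gcongr
      exact hu z h5 hz
    · rw [h1 hz, norm_zero, zero_mul]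
      positivity
  simpa [measureUnivNNReal] using h

theorem norm_rep_le_of_norm_le_one {u : BergmanSpace} (hu : ‖u‖ ≤ 1) {r : ℝ} (hr : r < 1)
    {z : ℂ} (hz : ‖z‖ ≤ r) : ‖rep u z‖ ≤ (1 - r)⁻¹ := by
  have h := (one_sub_norm_mul_norm_rep_le u (mem_ball_zero_iff.2 (hz.trans_lt hr))).trans hu
  rw [← one_div, le_div_iff₀' (sub_pos.2 hr)]
  exact (mul_le_mul_of_nonneg_right (by linarith) (norm_nonneg _)).trans h

/-- Elements of the unit ball of the Bergman space are uniformly Lipschitz on smaller disks. -/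
theorem exists_lipschitz_rep {r : ℝ} (hr : r < 1) :
    ∃ C : ℝ, ∀ u : BergmanSpace, ‖u‖ ≤ 1 → ∀ x y : ℂ, ‖x‖ ≤ r → ‖y‖ ≤ r →
      dist (rep u x) (rep u y) ≤ C * dist x y := by
  set δ : ℝ := (1 - r) / 2 with hδ
  have hδ0 : 0 < δ := by rw [hδ]; linarith
  set M : ℝ := (1 - (1 + r) / 2)⁻¹ with hM
  have hM0 : 0 < M := by rw [hM]; refine inv_pos.2 ?_; linarith
  refine ⟨2 * M / δ, fun u hu x y hx hy => ?_⟩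
  have hb : ∀ z : ℂ, ‖z‖ ≤ (1 + r) / 2 → ‖rep u z‖ ≤ M := fun z hz =>
    norm_rep_le_of_norm_le_one hu (by linarith) hz
  have hxy : ∀ z : ℂ, ‖z‖ ≤ (1 + r) / 2 → dist (rep u z) (rep u y) ≤ 2 * M := fun z hz => by
    rw [dist_eq_norm]
    have := norm_sub_le (rep u z) (rep u y)
    have := hb z hz
    have := hb y (by linarith)
    linarith
  rcases lt_or_ge (dist x y) δ with h | h
  -- Nearby points are handled by the Schwarz lemma on a ball of radius `δ`, which stays inside norm
  -- `(1 + r) / 2`; points further apart by the sup bound.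
  · refine Complex.dist_le_div_mul_dist_of_mapsTo_ball (c := y) (R₁ := δ) ?_ ?_ h
    · refine (differentiableOn_rep u).mono (Metric.ball_subset_ball' ?_)
      rw [dist_zero_right]
      linarith
    · intro z hz
      refine hxy z ?_
      have h1 := mem_ball_iff_norm.1 hz
      have h2 := norm_sub_norm_le z y
      linarith
  · refine (hxy x (by linarith)).trans ?_
    rw [div_mul_eq_mul_div, le_div_iff₀ hδ0]
    gcongr

/-- Only the restriction of `u` to the closed disk of radius `r` matters, and by Arzelà–Ascoli these
restrictions form a totally bounded set in the sup norm as `u` runs over the unit ball. -/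
theorem isCompactOperator_mulOp_incl_of_eq_zero {φ : Lp ℂ ∞ diskMeasure} {r : ℝ} (hr : r < 1)
    (hφ : ∀ᵐ z ∂diskMeasure, r < ‖z‖ → φ z = 0) :
    IsCompactOperator (mulOp φ ∘L incl) := by
  have hsub : ∀ x : Metric.closedBall (0 : ℂ) r, (x : ℂ) ∈ disk := fun x =>
    Metric.closedBall_subset_ball hr x.2
  have hcont : ∀ u : BergmanSpace, Continuous fun x : Metric.closedBall (0 : ℂ) r => rep u x :=
    fun u => continuousOn_iff_continuous_domRestrict.1
      ((differentiableOn_rep u).continuousOn.mono (Metric.closedBall_subset_ball hr))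
  let R : BergmanSpace → BoundedContinuousFunction (Metric.closedBall (0 : ℂ) r) ℂ := fun u =>
    BoundedContinuousFunction.mkOfCompact ⟨fun x => rep u x, hcont u⟩
  obtain ⟨C, hC⟩ := exists_lipschitz_rep hr
  have hA : TotallyBounded (R '' Metric.closedBall 0 1) := by
    refine (BoundedContinuousFunction.arzela_ascoli (Metric.closedBall (0 : ℂ) (1 - r)⁻¹)
      (isCompact_closedBall _ _) _ ?_ ?_).totallyBounded.subset subset_closure
    · rintro _ x ⟨u, hu, rfl⟩
      exact mem_closedBall_zero_iff.2
        (norm_rep_le_of_norm_le_one (mem_closedBall_zero_iff.1 hu) hr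
          (mem_closedBall_zero_iff.1 x.2))
    · refine Metric.equicontinuous_of_continuity_modulus (fun t => C * t) ?_ _ ?_
      · simpa using (continuous_const_mul C).tendsto 0
      · rintro x y ⟨_, u, hu, rfl⟩
        exact hC u (mem_closedBall_zero_iff.1 hu) x y (mem_closedBall_zero_iff.1 x.2)
          (mem_closedBall_zero_iff.1 y.2)
  have hT : TotallyBounded ((mulOp φ ∘L incl) '' Metric.closedBall 0 1) := by
    rw [Metric.totallyBounded_iff]
    intro ε hε
    obtain ⟨η, hη, hηε⟩ : ∃ η > 0, ‖φ‖ * η < ε :=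
      ⟨ε / (‖φ‖ + 1), by positivity, by
        rw [mul_div_assoc', div_lt_iff₀ (by positivity)]
        nlinarith [norm_nonneg φ]⟩
    obtain ⟨t, hts, htf, hcov⟩ := Metric.finite_approx_of_totallyBounded hA η hη
    obtain ⟨s, hs, hsf, rfl⟩ := Set.exists_subset_image_finite_and.1 ⟨t, hts, htf, rfl⟩
    refine ⟨(mulOp φ ∘L incl) '' s, hsf.image _, ?_⟩
    rintro _ ⟨u, hu, rfl⟩
    obtain ⟨_, ⟨v, hv, rfl⟩, hd⟩ := Set.mem_iUnion₂.1 (hcov (Set.mem_image_of_mem R hu))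
    refine Set.mem_iUnion₂.2 ⟨_, Set.mem_image_of_mem _ hv, ?_⟩
    rw [mem_ball_iff_norm, ← map_sub]
    refine (norm_mulOp_incl_le hφ hη.le fun z hz hzr => ?_).trans_lt hηε
    rw [rep_sub _ _ hz, ← dist_eq_norm]
    exact ((BoundedContinuousFunction.dist_coe_le_dist (f := R u) (g := R v)
      ⟨z, mem_closedBall_zero_iff.2 hzr⟩).trans_lt hd).le
  exact (isCompactOperator_iff_isCompact_closure_image_closedBall
    (mulOp φ ∘L incl).toLinearMap one_pos).2 (hT.closure.isCompact_of_isClosed isClosed_closure)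

/-- Multiplication by a bounded function vanishing at the boundary is compact on the Bergman
space. -/
theorem isCompactOperator_mulOp_incl {φ : Lp ℂ ∞ diskMeasure}
    (hφ : ∀ ε > 0, ∃ r < 1, ∀ᵐ z ∂diskMeasure, r < ‖z‖ → ‖φ z‖ ≤ ε) :
    IsCompactOperator (mulOp φ ∘L incl) := by
  have hmem : mulOp φ ∘L incl ∈ closure {T : BergmanSpace →L[ℂ] Lp ℂ 2 diskMeasure |
      IsCompactOperator T} := by
    rw [Metric.mem_closure_iff]
    intro ε hε
    obtain ⟨r, hr, h⟩ := hφ (ε / 2) (half_pos hε)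
    have hm : MemLp ((Metric.closedBall (0 : ℂ) r).indicator φ) ∞ diskMeasure :=
      (Lp.memLp φ).indicator Metric.isClosed_closedBall.measurableSet
    refine ⟨mulOp hm.toLp ∘L incl, isCompactOperator_mulOp_incl_of_eq_zero hr ?_, ?_⟩
    · filter_upwards [hm.coeFn_toLp] with z hz hzr
      rw [hz, Set.indicator_of_notMem]
      rwa [mem_closedBall_zero_iff, not_le]
    · have hn : ‖mulOp (φ - hm.toLp)‖ ≤ ε / 2 := by
        refine norm_mulOp_le (half_pos hε).le ?_
        filter_upwards [hm.coeFn_toLp, Lp.coeFn_sub φ hm.toLp, h] with z h1 h2 h3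
        rw [h2, Pi.sub_apply, h1]
        by_cases hz : z ∈ Metric.closedBall (0 : ℂ) r
        · rw [Set.indicator_of_mem hz, sub_self, norm_zero]
          exact (half_pos hε).le
        · rw [Set.indicator_of_notMem hz, sub_zero]
          rw [mem_closedBall_zero_iff, not_le] at hz
          exact h3 hz
      have hsub : mulOp φ ∘L incl - mulOp hm.toLp ∘L incl = mulOp (φ - hm.toLp) ∘L incl := by
        rw [mulOp, mulOp, mulOp, map_sub, ContinuousLinearMap.sub_comp]
      rw [dist_eq_norm, hsub]
      refine (ContinuousLinearMap.opNorm_comp_le _ _).trans_lt ?_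
      have hi : ‖incl‖ ≤ 1 := ContinuousLinearMap.opNorm_le_bound _ zero_le_one fun u => by
        rw [norm_incl, one_mul]
      nlinarith [norm_nonneg incl, norm_nonneg (mulOp (φ - hm.toLp))]
  rwa [isClosed_setOfPred_isCompactOperator.closure_eq] at hmem

/-! ### The compact Hankel operator and the Toeplitz algebra modulo compacts. -/

theorem memLp_conj : MemLp (fun z => starRingEnd ℂ z) ∞ diskMeasure :=
  memLp_top_of_bound Complex.continuous_conj.aestronglyMeasurable 1
    (ae_diskMeasure_mem.mono fun z hz => by
      rw [RCLike.norm_conj]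
      exact (mem_ball_zero_iff.1 hz).le)

theorem memLp_norm_sq_sub_one : MemLp (fun z : ℂ => ((‖z‖ ^ 2 - 1 : ℝ) : ℂ)) ∞ diskMeasure :=
  memLp_top_of_bound (by fun_prop) 1
    (ae_diskMeasure_mem.mono fun z hz => by
      have := mem_ball_zero_iff.1 hz
      rw [Complex.norm_real, Real.norm_eq_abs, abs_le]
      constructor <;> nlinarith [norm_nonneg z])

/-- Multiplication by the coordinate function on `L²(D)`. -/
def coordOp : Lp ℂ 2 diskMeasure →L[ℂ] Lp ℂ 2 diskMeasure :=
  mulOp (isHInfty_polynomial Polynomial.X).symbol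

theorem adjoint_coordOp : ContinuousLinearMap.adjoint coordOp = mulOp memLp_conj.toLp := by
  refine adjoint_mulOp ?_
  filter_upwards [memLp_conj.coeFn_toLp, (isHInfty_polynomial Polynomial.X).symbol_ae] with z h1 h2
  rw [h1, h2, Polynomial.eval_X]

/-- With `B` the backward shift, `u = u(0) + z B u` gives `conj z · u - B u = (|z|² - 1) B u + u(0)
conj z`: a multiplier vanishing at the boundary plus a rank-one operator. -/
theorem isCompactOperator_adjoint_coordOp_sub :
    IsCompactOperator (ContinuousLinearMap.adjoint coordOp ∘L incl - incl ∘L backwardShift) := by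
  have h1 : IsCompactOperator ((mulOp memLp_norm_sq_sub_one.toLp ∘L incl) ∘L backwardShift) := by
    refine IsCompactOperator.comp_clm (isCompactOperator_mulOp_incl fun ε hε => ?_) backwardShift
    -- On the disk, `1 - ‖z‖² ≤ 2 (1 - ‖z‖)`.
    refine ⟨1 - ε / 2, by linarith, ?_⟩
    filter_upwards [memLp_norm_sq_sub_one.coeFn_toLp, ae_diskMeasure_mem] with z hz hzd hr
    have := mem_ball_zero_iff.1 hzd
    rw [hz, Complex.norm_real, Real.norm_eq_abs, abs_le]
    constructor <;> nlinarith [norm_nonneg z]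
  have h2 : IsCompactOperator
      (ContinuousLinearMap.toSpanSingleton ℂ (ContinuousLinearMap.adjoint coordOp (incl one)) ∘L
        evalL zero_mem_disk) :=
    (isCompactOperator_of_locallyCompactSpace_dom (evalL zero_mem_disk)).clm_comp
      (ContinuousLinearMap.toSpanSingleton ℂ (ContinuousLinearMap.adjoint coordOp (incl one)))
  refine isCompactOperator_add_of_eq h1 h2 ?_
  ext1 u
  rw [_root_.sub_apply, _root_.add_apply]
  have h0 : evalL zero_mem_disk u = rep u 0 := by simp [evalL, evalₗ]
  simp only [ContinuousLinearMap.comp_apply, ContinuousLinearMap.toSpanSingleton_apply, h0]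
  rw [← map_smul, ← map_smul, adjoint_coordOp, sub_eq_iff_eq_add, add_right_comm,
    ← sub_eq_iff_eq_add, ← map_sub, ← map_sub, ← shift_backwardShift]
  refine Lp.ext ?_
  filter_upwards [mulOp_ae memLp_conj.toLp (incl (shift (backwardShift u))),
    Lp.coeFn_add (mulOp memLp_norm_sq_sub_one.toLp (incl (backwardShift u)))
      (incl (backwardShift u)), mulOp_ae memLp_norm_sq_sub_one.toLp (incl (backwardShift u)),
    memLp_conj.coeFn_toLp, memLp_norm_sq_sub_one.coeFn_toLp, incl_ae_eq_rep (backwardShift u),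
    incl_ae_eq_rep (shift (backwardShift u)), ae_diskMeasure_mem] with z e1 e2 e3 e4 e5 e6 e7 e8
  rw [e1, e2, Pi.add_apply, e3, e4, e5, e6, e7, rep_shift _ e8, ← mul_assoc, Complex.conj_mul']
  push_cast
  ring

theorem isCompactOperator_hankel :
    IsCompactOperator ((ContinuousLinearMap.id ℂ _ - incl ∘L proj) ∘L
      ContinuousLinearMap.adjoint coordOp ∘L incl) := by
  refine isCompactOperator_of_eq (S := (ContinuousLinearMap.id ℂ _ - incl ∘L proj) ∘L
    (ContinuousLinearMap.adjoint coordOp ∘L incl - incl ∘L backwardShift))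
    (isCompactOperator_adjoint_coordOp_sub.clm_comp _) ?_
  ext1 u
  simp only [ContinuousLinearMap.comp_apply, _root_.sub_apply, map_sub,
    ContinuousLinearMap.id_apply, proj_incl, sub_self, sub_zero]

theorem incl_comp_shift : incl ∘L shift = coordOp ∘L incl := by
  ext1 u
  exact incl_toeplitz_symbol (isHInfty_polynomial Polynomial.X) u

theorem adjoint_shift_comp_proj : ContinuousLinearMap.adjoint shift ∘L proj =
    proj ∘L ContinuousLinearMap.adjoint coordOp := by
  have h := congrArg ContinuousLinearMap.adjoint incl_comp_shift
  rwa [ContinuousLinearMap.adjoint_comp, ContinuousLinearMap.adjoint_comp, adjoint_incl] at h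

theorem adjoint_compression (A : Lp ℂ 2 diskMeasure →L[ℂ] Lp ℂ 2 diskMeasure) :
    ContinuousLinearMap.adjoint (proj ∘L A ∘L incl) =
      proj ∘L ContinuousLinearMap.adjoint A ∘L incl := by
  rw [ContinuousLinearMap.adjoint_comp, ContinuousLinearMap.adjoint_comp, adjoint_incl,
    ← adjoint_incl, ContinuousLinearMap.adjoint_adjoint]
  rfl

/-- Since `A` commutes with multiplication by `conj z`, the commutator equals `P A (1 - P) conj z`,
which contains the Hankel operator as a factor. -/
theorem isCompactOperator_commutator_compression {A : Lp ℂ 2 diskMeasure →L[ℂ] Lp ℂ 2 diskMeasure}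
    (hA : Commute A (ContinuousLinearMap.adjoint coordOp)) :
    IsCompactOperator (ContinuousLinearMap.adjoint shift ∘L (proj ∘L A ∘L incl) -
      (proj ∘L A ∘L incl) ∘L ContinuousLinearMap.adjoint shift) := by
  refine isCompactOperator_of_eq (S := (proj ∘L A) ∘L
    ((ContinuousLinearMap.id ℂ (Lp ℂ 2 diskMeasure) - incl ∘L proj) ∘L
      ContinuousLinearMap.adjoint coordOp ∘L incl)) (isCompactOperator_hankel.clm_comp (proj ∘L A)) ?_
  have hs : ContinuousLinearMap.adjoint shift =
      proj ∘L ContinuousLinearMap.adjoint coordOp ∘L incl := adjoint_compression coordOp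
  have h1 : ∀ F, ContinuousLinearMap.adjoint shift (proj F) =
      proj (ContinuousLinearMap.adjoint coordOp F) := fun F =>
    congrArg (fun T : Lp ℂ 2 diskMeasure →L[ℂ] BergmanSpace => T F) adjoint_shift_comp_proj
  have h2 : ∀ F, A (ContinuousLinearMap.adjoint coordOp F) =
      ContinuousLinearMap.adjoint coordOp (A F) := fun F =>
    congrArg (fun T : Lp ℂ 2 diskMeasure →L[ℂ] Lp ℂ 2 diskMeasure => T F) hA.eq
  ext1 u
  simp only [ContinuousLinearMap.comp_apply, _root_.sub_apply, map_sub,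
    ContinuousLinearMap.id_apply, h1, h2]
  simp only [hs, ContinuousLinearMap.comp_apply]

/-- Operators in the Toeplitz algebra commute with the adjoint of the shift modulo compact
operators. -/
theorem isCompactOperator_commutator_of_mem_toeplitzAlgebra
    {S : BergmanSpace →L[ℂ] BergmanSpace} (hS : S ∈ toeplitzAlgebra) :
    IsCompactOperator (star shift * S - S * star shift) := by
  have hcl : IsClosed {S : BergmanSpace →L[ℂ] BergmanSpace |
      IsCompactOperator (star shift * S - S * star shift)} :=
    isClosed_setOfPred_isCompactOperator.preimage
      (f := fun S : BergmanSpace →L[ℂ] BergmanSpace => star shift * S - S * star shift)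
      (by fun_prop)
  -- Carrying the claim for `T` and `star T` together lets the induction pass through adjoints,
  -- which swap the two halves.
  suffices h : ∀ T ∈ StarAlgebra.adjoin ℂ (Set.range toeplitz),
      IsCompactOperator (star shift * T - T * star shift) ∧
      IsCompactOperator (star shift * star T - star T * star shift) from
    hcl.closure_subset_iff.2 (fun T hT => (h T hT).1) hS
  intro T hT
  induction hT using StarAlgebra.adjoin_induction with
  | mem T hT =>
    obtain ⟨φ, rfl⟩ := hT
    refine ⟨isCompactOperator_commutator_compression ?_, ?_⟩
    · rw [adjoint_coordOp]
      exact mulOp_commute _ _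
    · rw [toeplitz, ContinuousLinearMap.star_eq_adjoint (proj ∘L mulOp φ ∘L incl),
        adjoint_compression]
      refine isCompactOperator_commutator_compression ?_
      exact (mulOp_commute φ (isHInfty_polynomial Polynomial.X).symbol).star_star
  | algebraMap r =>
    rw [← algebraMap_star_comm, (Algebra.commutes r (star shift)).symm,
      (Algebra.commutes (star r) (star shift)).symm, sub_self, sub_self]
    exact ⟨isCompactOperator_zero, isCompactOperator_zero⟩
  | add S T _ _ hS hT =>
    rw [star_add]
    exact ⟨isCompactOperator_add_of_eq hS.1 hT.1 (by noncomm_ring),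
      isCompactOperator_add_of_eq hS.2 hT.2 (by noncomm_ring)⟩
  | mul S T _ _ hS hT =>
    rw [star_mul]
    exact ⟨isCompactOperator_add_of_eq (R := (star shift * S - S * star shift) * T)
        (S := S * (star shift * T - T * star shift)) (hS.1.comp_clm T) (hT.1.clm_comp S)
        (by noncomm_ring),
      isCompactOperator_add_of_eq (R := (star shift * star T - star T * star shift) * star S)
        (S := star T * (star shift * star S - star S * star shift)) (hT.2.comp_clm (star S))
        (hS.2.clm_comp (star T)) (by noncomm_ring)⟩
  | star S _ hS =>
    rw [star_star]
    exact hS.symm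

/-! ### Uniqueness for bounded holomorphic functions vanishing at an arc. -/

/-- Some quarter turn brings `v` within 45 degrees of the positive real axis, and `cos 45° > 1/2`.
-/
theorem exists_rotation_re_ge (v : ℂ) : ∃ j : Fin 4, ‖v‖ / 2 ≤ (Complex.I ^ (j : ℕ) * v).re := by
  by_contra! h
  have h0 := h 0
  have h1 := h 1
  have h2 := h 2
  have h3 := h 3
  simp [pow_succ] at h0 h1 h2 h3
  have h4 := Complex.sq_norm v
  rw [Complex.normSq_apply] at h4
  have h5 := norm_nonneg v
  nlinarith

/-- With `s = 1 - t`, the squared norm is at least `t² + 16 s² + 4 t s = 1 + 2 s + 13 s²`. This is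
why the radius `4 (1 - t)` is used below. -/
theorem one_lt_norm_add_of_re_ge {c v w₀ : ℂ} {t : ℝ} (hw₀ : ‖w₀‖ = 1) (ht : 1 / 2 ≤ t)
    (ht1 : t < 1) (hc : c = t * w₀) (hv : ‖v‖ = 4 * (1 - t))
    (hre : ‖v‖ / 2 ≤ (starRingEnd ℂ w₀ * v).re) : 1 < ‖c + v‖ := by
  have h1 : ‖c + v‖ ^ 2 = t ^ 2 + ‖v‖ ^ 2 + 2 * (t * (starRingEnd ℂ w₀ * v).re) := by
    rw [Complex.sq_norm, Complex.normSq_add, ← Complex.sq_norm, ← Complex.sq_norm, hc, norm_mul,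
      hw₀, Complex.norm_real, mul_one, Real.norm_eq_abs, sq_abs]
    simp only [Complex.mul_re, Complex.conj_re, Complex.conj_im, Complex.mul_im, Complex.ofReal_re,
      Complex.ofReal_im]
    ring
  have h2 : 1 < ‖c + v‖ ^ 2 := by
    rw [h1, hv]
    rw [hv] at hre
    nlinarith
  nlinarith [norm_nonneg (c + v)]

theorem norm_rotation (j : ℕ) (v : ℂ) : ‖Complex.I ^ j * v‖ = ‖v‖ := by simp

/-- A bounded holomorphic function tending to zero at an arc of the circle vanishes along the radius
at the centre of the arc: multiply four rotated copies around a point of the radius. -/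
theorem eq_zero_on_radius {h : ℂ → ℂ} {w₀ : ℂ} {ε M t : ℝ} (hw₀ : ‖w₀‖ = 1)
    (hd : DifferentiableOn ℂ h (Metric.ball w₀ ε ∩ disk))
    (hM : ∀ w ∈ Metric.ball w₀ ε ∩ disk, ‖h w‖ ≤ M)
    (h0 : ∀ η > 0, ∃ ρ < 1, ∀ w ∈ Metric.ball w₀ ε ∩ disk, ρ < ‖w‖ → ‖h w‖ ≤ η)
    (ht : 1 / 2 ≤ t) (ht1 : t < 1) (htε : 5 * (1 - t) < ε) : h (t * w₀) = 0 := by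
  set c : ℂ := t * w₀ with hc
  have hcn : ‖c‖ = t := by
    rw [hc, norm_mul, hw₀, Complex.norm_real, Real.norm_of_nonneg (by linarith), mul_one]
  have hcw : ‖c - w₀‖ = 1 - t := by
    have : c - w₀ = ((t - 1 : ℝ) : ℂ) * w₀ := by
      rw [hc]
      push_cast
      ring
    rw [this, norm_mul, hw₀, Complex.norm_real, Real.norm_eq_abs, abs_of_nonpos (by linarith)]
    ring
  have hM0 : 0 ≤ M := (norm_nonneg _).trans (hM c ⟨by
    rw [mem_ball_iff_norm, hcw]
    linarith, by
    rw [mem_ball_zero_iff, hcn]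
    exact ht1⟩)
  let p : Fin 4 → ℂ → ℂ := fun j z => c + Complex.I ^ (j : ℕ) * (z - c)
  have hpc : ∀ j, Continuous (p j) := fun j => by fun_prop
  have key : ∀ η > 0, ‖h c‖ ^ 4 ≤ η * M ^ 3 := by
    intro η hη
    obtain ⟨ρ₀, hρ₀, hρh⟩ := h0 η hη
    obtain ⟨ρ, hρ, hρ1⟩ := exists_between (max_lt hρ₀ ht1)
    -- At each frontier point of `U` one of the four copies has norm `ρ`, so one factor of the
    -- product is at most `η` and the other three at most `M`; the maximum principle carries this to
    -- the common centre `c`.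
    set U : Set ℂ := {z | ‖z - c‖ < 4 * (1 - t) ∧ ∀ j, ‖p j z‖ < ρ} with hU
    have hUo : IsOpen U := by
      rw [hU, Set.ofPred_and, Set.ofPred_forall]
      exact (isOpen_lt (by fun_prop) continuous_const).inter
        (isOpen_iInter_of_finite fun j => isOpen_lt (hpc j).norm continuous_const)
    have hUcl : closure U ⊆ {z | ‖z - c‖ ≤ 4 * (1 - t) ∧ ∀ j, ‖p j z‖ ≤ ρ} := by
      refine closure_minimal (fun z hz => ⟨hz.1.le, fun j => (hz.2 j).le⟩) ?_
      rw [Set.ofPred_and, Set.ofPred_forall]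
      exact (isClosed_le (by fun_prop) continuous_const).inter
        (isClosed_iInter fun j => isClosed_le (hpc j).norm continuous_const)
    have hmaps : ∀ z ∈ closure U, ∀ j, p j z ∈ Metric.ball w₀ ε ∩ disk := by
      intro z hz j
      obtain ⟨hz1, hz2⟩ := hUcl hz
      refine ⟨?_, mem_ball_zero_iff.2 ((hz2 j).trans_lt hρ1)⟩
      rw [mem_ball_iff_norm]
      calc ‖p j z - w₀‖ = ‖(c - w₀) + Complex.I ^ (j : ℕ) * (z - c)‖ := by
            congr 1
            simp only [p]
            ring
        _ ≤ ‖c - w₀‖ + ‖z - c‖ := (norm_add_le _ _).trans (by rw [norm_rotation])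
        _ < ε := by rw [hcw]; linarith
    have hbd : Bornology.IsBounded U := by
      refine Metric.isBounded_ball.subset (t := Metric.ball c (4 * (1 - t))) fun z hz => ?_
      rw [mem_ball_iff_norm]
      exact hz.1
    have hF : DiffContOnCl ℂ (fun z => ∏ j, h (p j z)) U := by
      refine DifferentiableOn.diffContOnCl ?_
      refine DifferentiableOn.fun_finsetProd fun j _ => ?_
      exact hd.comp (by fun_prop) fun z hz => hmaps z hz j
    have hfr : ∀ z ∈ frontier U, ‖∏ j, h (p j z)‖ ≤ η * M ^ 3 := by
      intro z hz
      have hzc : z ∈ closure U := frontier_subset_closure hz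
      obtain ⟨hz1, hz2⟩ := hUcl hzc
      have hzU : z ∉ U := by
        rw [hUo.frontier_eq] at hz
        exact hz.2
      obtain ⟨j, hj⟩ : ∃ j, ρ ≤ ‖p j z‖ := by
        by_contra! hcon
        -- On the circle `‖z - c‖ = 4 (1 - t)` some copy would leave the unit disk, so that circle
        -- contributes no frontier points.
        refine hzU ⟨lt_of_le_of_ne hz1 fun heq => ?_, hcon⟩
        obtain ⟨j, hj⟩ := exists_rotation_re_ge (starRingEnd ℂ w₀ * (z - c))
        rw [norm_mul, RCLike.norm_conj, hw₀, one_mul, mul_left_comm,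
          ← norm_rotation j (z - c)] at hj
        rw [← norm_rotation (j : Fin 4) (z - c)] at heq
        have := one_lt_norm_add_of_re_ge hw₀ ht ht1 hc heq hj
        have := hcon j
        simp only [p] at this
        linarith
      rw [norm_prod, ← Finset.mul_prod_erase _ _ (Finset.mem_univ j)]
      gcongr
      · exact hρh _ (hmaps z hzc j) (((le_max_left _ _).trans_lt hρ).trans_le hj)
      · refine (Finset.prod_le_prod (fun i _ => norm_nonneg _)
          fun i _ => hM _ (hmaps z hzc i)).trans_eq ?_
        simp
    have hcU : c ∈ U := by
      refine ⟨by simpa using ht1, fun j => ?_⟩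
      simp only [p, sub_self, mul_zero, add_zero, hcn]
      exact (le_max_right _ _).trans_lt hρ
    have := Complex.norm_le_of_forall_mem_frontier_norm_le hbd hF hfr (subset_closure hcU)
    simpa [p] using this
  have hle : ‖h c‖ ^ 4 ≤ 0 := by
    refine le_of_forall_pos_le_add fun e he => ?_
    refine (key (e / (M ^ 3 + 1)) (by positivity)).trans ?_
    rw [div_mul_eq_mul_div, zero_add, div_le_iff₀ (by positivity)]
    nlinarith
  exact norm_eq_zero.1 (eq_zero_of_pow_eq_zero (le_antisymm hle (by positivity)))

theorem isPreconnected_ball_inter_disk (w₀ : ℂ) (ε : ℝ) :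
    IsPreconnected (Metric.ball w₀ ε ∩ disk) :=
  ((convex_ball w₀ ε).inter (convex_ball 0 1)).isPreconnected

theorem isOpen_ball_inter_disk (w₀ : ℂ) (ε : ℝ) : IsOpen (Metric.ball w₀ ε ∩ disk) :=
  Metric.isOpen_ball.inter Metric.isOpen_ball

/-- A bounded holomorphic function near a boundary point of the disk vanishes if it tends to zero
at the boundary. -/
theorem eqOn_zero_of_boundary {h : ℂ → ℂ} {w₀ : ℂ} {ε M : ℝ} (hw₀ : ‖w₀‖ = 1) (hε : 0 < ε)
    (hd : DifferentiableOn ℂ h (Metric.ball w₀ ε ∩ disk))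
    (hM : ∀ w ∈ Metric.ball w₀ ε ∩ disk, ‖h w‖ ≤ M)
    (h0 : ∀ η > 0, ∃ ρ < 1, ∀ w ∈ Metric.ball w₀ ε ∩ disk, ρ < ‖w‖ → ‖h w‖ ≤ η) :
    Set.EqOn h 0 (Metric.ball w₀ ε ∩ disk) := by
  obtain ⟨s, hs0, hs⟩ : ∃ s > 0, s < min (1 / 2) (ε / 5) :=
    exists_between (lt_min (by norm_num) (by positivity))
  have hs1 : s < 1 / 2 := hs.trans_le (min_le_left _ _)
  have hs2 : s < ε / 5 := hs.trans_le (min_le_right _ _)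
  have hmem : ((1 - s : ℝ) : ℂ) * w₀ ∈ Metric.ball w₀ ε ∩ disk := by
    constructor
    · rw [mem_ball_iff_norm]
      have : ((1 - s : ℝ) : ℂ) * w₀ - w₀ = ((-s : ℝ) : ℂ) * w₀ := by
        push_cast
        ring
      rw [this, norm_mul, hw₀, Complex.norm_real, Real.norm_eq_abs, abs_neg, abs_of_pos hs0]
      linarith
    · rw [mem_ball_zero_iff, norm_mul, hw₀, Complex.norm_real, Real.norm_of_nonneg (by linarith)]
      linarith
  refine (hd.analyticOnNhd (isOpen_ball_inter_disk _ _)).eqOn_zero_of_preconnected_of_frequently_eq_zero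
    (isPreconnected_ball_inter_disk _ _) hmem ?_
  have hw0 : w₀ ≠ 0 := fun h => by simp [h] at hw₀
  have ht : Tendsto (fun t : ℝ => (t : ℂ) * w₀) (𝓝[≠] (1 - s)) (𝓝[≠] (((1 - s : ℝ) : ℂ) * w₀)) := by
    refine tendsto_nhdsWithin_of_tendsto_nhds_of_eventually_within _ ?_ ?_
    · exact ((by fun_prop : Continuous fun t : ℝ => (t : ℂ) * w₀).tendsto _).mono_left
        nhdsWithin_le_nhds
    · filter_upwards [self_mem_nhdsWithin] with t ht heq
      exact ht (Complex.ofReal_injective (mul_right_cancel₀ hw0 heq))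
  refine ht.frequently (Eventually.frequently ?_)
  have hI : Set.Ioo (max (1 / 2) (1 - ε / 5)) 1 ∈ 𝓝 (1 - s) :=
    Ioo_mem_nhds (max_lt (by linarith) (by linarith)) (by linarith)
  filter_upwards [nhdsWithin_le_nhds hI] with t ht
  have h1 := (le_max_left _ _).trans_lt ht.1
  have h2 := (le_max_right _ _).trans_lt ht.1
  exact eq_zero_on_radius hw₀ hd hM h0 h1.le ht.2 (by linarith)

/-! ### Analytic functions of modulus one on an arc. -/

/-- If an analytic function has modulus one at points of the circle accumulating at `w₀`, then it
has modulus one on an arc around `w₀`. -/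
theorem eventually_norm_eq_one_of_frequently {σ : ℂ → ℂ} {w₀ : ℂ} (hw₀ : ‖w₀‖ = 1)
    (hσ : AnalyticAt ℂ σ w₀) (hf : ∃ᶠ w in 𝓝[≠] w₀, ‖w‖ = 1 ∧ ‖σ w‖ = 1) :
    ∀ᶠ w in 𝓝 w₀, ‖w‖ = 1 → ‖σ w‖ = 1 := by
  have hw0 : w₀ ≠ 0 := fun h => by simp [h] at hw₀
  -- Along the circle, `‖σ‖² - 1` is a real-analytic function of the angle, so its zeros are
  -- isolated unless it vanishes near zero.
  let e : ℝ → ℂ := fun θ => w₀ * Complex.exp (θ * Complex.I)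
  have he0 : e 0 = w₀ := by simp [e]
  have he : AnalyticAt ℝ e 0 := by
    have h1 : AnalyticAt ℂ (fun z : ℂ => w₀ * Complex.exp (z * Complex.I)) (0 : ℝ) := by fun_prop
    exact h1.restrictScalars.comp (Complex.ofRealCLM.analyticAt 0)
  have hσe : AnalyticAt ℝ (fun θ => σ (e θ)) 0 :=
    AnalyticAt.fun_comp (by rw [he0]; exact hσ.restrictScalars) he
  have hr : AnalyticAt ℝ (fun θ => (σ (e θ)).re ^ 2 + (σ (e θ)).im ^ 2 - 1) 0 :=
    ((((Complex.reCLM.analyticAt _).fun_comp hσe).pow 2).add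
      (((Complex.imCLM.analyticAt _).fun_comp hσe).pow 2)).sub analyticAt_const
  have hre : ∀ θ, (σ (e θ)).re ^ 2 + (σ (e θ)).im ^ 2 - 1 = 0 ↔ ‖σ (e θ)‖ = 1 := fun θ => by
    have h1 : (σ (e θ)).re ^ 2 + (σ (e θ)).im ^ 2 = ‖σ (e θ)‖ ^ 2 := by
      rw [Complex.sq_norm, Complex.normSq_apply]
      ring
    rw [h1, sub_eq_zero, pow_eq_one_iff_of_nonneg (norm_nonneg _) two_ne_zero]
  let ψ : ℂ → ℝ := fun w => Complex.arg (w / w₀)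
  have hψ : Tendsto ψ (𝓝 w₀) (𝓝 0) := by
    have h1 : ContinuousAt ψ w₀ := by
      refine ContinuousAt.comp (g := Complex.arg) ?_ (by fun_prop)
      rw [div_self hw0]
      exact Complex.continuousAt_arg Complex.one_mem_slitPlane
    have h2 : ψ w₀ = 0 := by simp [ψ]
    rw [← h2]
    exact h1
  have hψe : ∀ w, ‖w‖ = 1 → e (ψ w) = w := fun w hw => by
    have h1 := Complex.norm_mul_exp_arg_mul_I (w / w₀)
    rw [norm_div, hw, hw₀, div_one, Complex.ofReal_one, one_mul] at h1
    simp only [e, ψ, h1]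
    field_simp
  rcases hr.eventually_eq_zero_or_eventually_ne_zero with h | h
  · filter_upwards [hψ.eventually h] with w hw hw1
    rw [hre, hψe w hw1] at hw
    exact hw
  · rw [eventually_nhdsWithin_iff] at h
    refine absurd (hψ.eventually h) fun hcon => hf ?_
    rw [eventually_nhdsWithin_iff]
    filter_upwards [hcon] with w hw hne ⟨h1, h2⟩
    refine hw (fun h3 => hne ?_) ((hre _).2 (by rwa [hψe w h1]))
    rw [← hψe w h1, h3, he0]
    rfl

/-- Compare `w` with its radial projection `w / ‖w‖`, where `σ` has modulus one; `σ` is Lipschitz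
near `w₀` and the two points are `1 - ‖w‖` apart. -/
theorem exists_one_sub_norm_le {σ : ℂ → ℂ} {w₀ : ℂ} (hw₀ : ‖w₀‖ = 1)
    (hσ : AnalyticAt ℂ σ w₀) (h : ∀ᶠ w in 𝓝 w₀, ‖w‖ = 1 → ‖σ w‖ = 1) :
    ∃ C : ℝ, 0 ≤ C ∧ ∀ᶠ w in 𝓝 w₀, ‖w‖ ≤ 1 → 1 - ‖σ w‖ ≤ C * (1 - ‖w‖) := by
  have hw0 : w₀ ≠ 0 := fun h => by simp [h] at hw₀
  obtain ⟨C, s, hs, hC⟩ := (hσ.contDiffAt (n := 1)).exists_lipschitzOnWith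
  have hcont : Tendsto (fun w : ℂ => w / ‖w‖) (𝓝 w₀) (𝓝 w₀) := by
    have h1 : ContinuousAt (fun w : ℂ => w / ‖w‖) w₀ := by
      refine continuousAt_id.div (by fun_prop) (by simpa using hw0)
    simpa [ContinuousAt, hw₀] using h1
  refine ⟨C, C.2, ?_⟩
  filter_upwards [hs, hcont hs, hcont.eventually h, eventually_ne_nhds hw0] with w h1 h2 h3 h4 h5
  have hn : ‖w‖ ≠ 0 := norm_ne_zero_iff.2 h4
  have h6 := h3 (by rw [norm_div, Complex.norm_real, norm_norm, div_self hn])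
  have h7 := hC.dist_le_mul _ h2 _ h1
  have h8 : dist (w / (‖w‖ : ℂ)) w = 1 - ‖w‖ := by
    have : w / (‖w‖ : ℂ) - w = (((1 - ‖w‖) / ‖w‖ : ℝ) : ℂ) * w := by
      have : (‖w‖ : ℂ) ≠ 0 := by exact_mod_cast hn
      push_cast
      field_simp
    rw [dist_eq_norm, this, norm_mul, Complex.norm_real, Real.norm_of_nonneg
      (div_nonneg (by linarith) (norm_nonneg _)), div_mul_cancel₀ _ hn]
  rw [h8, dist_eq_norm] at h7
  have h9 := norm_sub_norm_le (σ (w / ‖w‖)) (σ w)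
  rw [h6] at h9
  linarith

/-! ### The boundary of the image of the disk, and branches over regular values. -/

section Polynomial

variable {f : Polynomial ℂ}

/-- The points of the circle that a nonconstant polynomial maps outside the image of the disk form
an uncountable set. -/
theorem not_countable_boundary (hf : f.natDegree ≠ 0) :
    ¬ {w : ℂ | ‖w‖ = 1 ∧ f.eval w ∉ f.eval '' disk}.Countable := by
  intro hc
  set Ω : Set ℂ := f.eval '' disk with hΩ
  have hΩo : IsOpen Ω := (f.isOpenQuotientMap_eval hf).isOpenMap _ Metric.isOpen_ball
  have hK : IsCompact (f.eval '' Metric.closedBall 0 1) :=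
    (isCompact_closedBall 0 1).image f.continuous
  have hΩK : Ω ⊆ f.eval '' Metric.closedBall 0 1 := Set.image_mono Metric.ball_subset_closedBall
  have hfr : frontier Ω ⊆ f.eval '' {w : ℂ | ‖w‖ = 1 ∧ f.eval w ∉ Ω} := by
    intro p hp
    rw [hΩo.frontier_eq] at hp
    obtain ⟨w, hw, rfl⟩ := hK.isClosed.closure_subset_iff.2 hΩK hp.1
    refine ⟨w, ⟨le_antisymm (mem_closedBall_zero_iff.1 hw) ?_, hp.2⟩, rfl⟩
    by_contra! hlt
    exact hp.2 (Set.mem_image_of_mem _ (mem_ball_zero_iff.2 hlt))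
  have hcf : (frontier Ω).Countable := (hc.image _).mono hfr
  -- A countable set does not disconnect the plane, yet the frontier separates the bounded set `Ω`
  -- from its exterior.
  have hconn : IsPreconnected (frontier Ω)ᶜ :=
    (hcf.isPathConnected_compl_of_one_lt_rank (by simp)).isConnected.isPreconnected
  have hcover : (frontier Ω)ᶜ ⊆ Ω ∪ (closure Ω)ᶜ := by
    intro p hp
    by_cases h : p ∈ closure Ω
    · left
      by_contra hn
      rw [hΩo.frontier_eq] at hp
      exact hp ⟨h, hn⟩
    · exact Or.inr h
  have hne1 : ((frontier Ω)ᶜ ∩ Ω).Nonempty := by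
    refine ⟨f.eval 0, ?_, Set.mem_image_of_mem _ zero_mem_disk⟩
    rw [hΩo.frontier_eq]
    exact fun h => h.2 (Set.mem_image_of_mem _ zero_mem_disk)
  have hne2 : ((frontier Ω)ᶜ ∩ (closure Ω)ᶜ).Nonempty := by
    have hcl : IsCompact (closure Ω) := hK.closure_of_subset hΩK
    obtain ⟨p, hp⟩ : (closure Ω)ᶜ.Nonempty := by
      rw [Set.nonempty_compl]
      exact hcl.ne_univ
    exact ⟨p, fun h => hp (frontier_subset_closure h), hp⟩
  obtain ⟨p, -, hp1, hp2⟩ := hconn _ _ hΩo isClosed_closure.isOpen_compl hcover hne1 hne2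
  exact hp2 (subset_closure hp1)

theorem exists_frequently_of_not_countable {s : Set ℂ} (hs : ¬ s.Countable) :
    ∃ w ∈ s, ∃ᶠ z in 𝓝[≠] w, z ∈ s := by
  by_contra! h
  refine hs ((HereditarilyLindelofSpace.isLindelof s).countable_of_isDiscrete
    (isDiscrete_iff_nhdsNE.2 fun x hx => ?_))
  exact (inf_principal_eq_bot).2 (h x hx)

theorem finite_setOf_eval_eq (hf : f.natDegree ≠ 0) (c : ℂ) : {w : ℂ | f.eval w = c}.Finite := by
  have h : f - Polynomial.C c ≠ 0 := by
    intro h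
    rw [sub_eq_zero] at h
    rw [h] at hf
    simp at hf
  refine (f - Polynomial.C c).roots.toFinset.finite_toSet.subset fun w hw => ?_
  have hw' : f.eval w = c := hw
  simp [h, hw']

/-- There is a point of the circle over a regular value of the polynomial at which points of the
circle mapped outside the image of the disk accumulate. -/
theorem exists_regular_accumulation (hf : f.natDegree ≠ 0) :
    ∃ w₀ : ℂ, ‖w₀‖ = 1 ∧ (∀ c, f.eval c = f.eval w₀ → f.derivative.eval c ≠ 0) ∧
      ∃ᶠ w in 𝓝[≠] w₀, ‖w‖ = 1 ∧ f.eval w ∉ f.eval '' disk := by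
  have hd : f.derivative ≠ 0 := fun h => hf (Polynomial.derivative_eq_zero.1 h)
  -- The fibres through critical points form a finite set, so discarding them leaves an uncountable
  -- set.
  set B : Set ℂ := ⋃ c ∈ f.derivative.roots.toFinset, {w : ℂ | f.eval w = f.eval c} with hB
  have hBf : B.Finite := f.derivative.roots.toFinset.finite_toSet.biUnion fun c _ =>
    finite_setOf_eval_eq hf _
  have hunc : ¬ ({w : ℂ | ‖w‖ = 1 ∧ f.eval w ∉ f.eval '' disk} \ B).Countable := fun h =>
    not_countable_boundary hf ((h.union hBf.countable).mono (by simp))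
  obtain ⟨w₀, hw₀, hfreq⟩ := exists_frequently_of_not_countable hunc
  refine ⟨w₀, hw₀.1.1, fun c hc hc' => hw₀.2 ?_, hfreq.mono fun w hw => hw.1⟩
  exact Set.mem_iUnion₂.2 ⟨c, by simp [hd, hc'], hc.symm⟩

/-- Over a regular value `f - c` has no root in common with its derivative, so its roots are simple.
-/
theorem card_roots_toFinset_of_regular {c : ℂ}
    (hc : ∀ a, f.eval a = c → f.derivative.eval a ≠ 0) :
    (f - Polynomial.C c).roots.toFinset.card = f.natDegree := by
  have hsep : (f - Polynomial.C c).Separable := by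
    rw [Polynomial.Separable, Polynomial.isCoprime_iff_aeval_ne_zero_of_isAlgClosed ℂ ℂ]
    intro a
    by_cases h : f.eval a = c
    · right
      simpa using hc a h
    · left
      simpa [sub_eq_zero] using h
  rw [Multiset.toFinset_card_of_nodup (Polynomial.nodup_roots hsep),
    ← (IsAlgClosed.splits _).natDegree_eq_card_roots, Polynomial.natDegree_sub_C]

theorem exists_analytic_branch {w₀ a : ℂ} (ha : f.eval a = f.eval w₀)
    (hd : f.derivative.eval a ≠ 0) :
    ∃ σ : ℂ → ℂ, AnalyticAt ℂ σ w₀ ∧ σ w₀ = a ∧ ∀ᶠ w in 𝓝 w₀, f.eval (σ w) = f.eval w := by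
  have hcd : ContDiffAt ℂ ⊤ (fun z => f.eval z) a :=
    (AnalyticOnNhd.eval_polynomial f a (Set.mem_univ _)).contDiffAt
  have hfd := (f.hasDerivAt a).hasFDerivAt_equiv hd
  refine ⟨fun w => hcd.localInverse hfd WithTop.top_ne_zero (f.eval w), ?_, ?_, ?_⟩
  · refine AnalyticAt.fun_comp ?_ (AnalyticOnNhd.eval_polynomial f w₀ (Set.mem_univ _))
    rw [← ha]
    exact (hcd.to_localInverse hfd WithTop.top_ne_zero).analyticAt
  · simp only [← ha]
    exact hcd.localInverse_apply_image hfd WithTop.top_ne_zero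
  · have h := (hcd.hasStrictFDerivAt' hfd WithTop.top_ne_zero).eventually_right_inverse
    rw [ha] at h
    exact (f.continuous.tendsto w₀).eventually h

end Polynomial

/-! ### Divided differences and operators commuting with `T_f`. -/

theorem rep_shift_pow (i : ℕ) (u : BergmanSpace) {z : ℂ} (hz : z ∈ disk) :
    rep ((shift ^ i) u) z = z ^ i * rep u z := by
  induction i with
  | zero => simp
  | succ i ih =>
    rw [pow_succ', mul_apply_eq_comp, rep_shift _ hz, ih]
    ring

/-- Multiplication by the polynomial `(f(z) - f(a)) / (z - a)` on the Bergman space. -/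
def quotOp (f : Polynomial ℂ) (a : ℂ) : BergmanSpace →L[ℂ] BergmanSpace :=
  ∑ n ∈ Finset.range (f.natDegree + 1), ∑ i ∈ Finset.range n,
    (f.coeff n * a ^ (n - 1 - i)) • shift ^ i

theorem quotOp_apply (f : Polynomial ℂ) (a : ℂ) (u : BergmanSpace) :
    quotOp f a u = ∑ n ∈ Finset.range (f.natDegree + 1), ∑ i ∈ Finset.range n,
      (f.coeff n * a ^ (n - 1 - i)) • (shift ^ i) u := by
  simp [quotOp]

theorem rep_map_quotOp (f : Polynomial ℂ) (K : BergmanSpace →L[ℂ] BergmanSpace) (a : ℂ)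
    (u : BergmanSpace) {w : ℂ} (hw : w ∈ disk) :
    rep (K (quotOp f a u)) w = ∑ n ∈ Finset.range (f.natDegree + 1), ∑ i ∈ Finset.range n,
      f.coeff n * a ^ (n - 1 - i) * rep (K ((shift ^ i) u)) w := by
  simp only [quotOp_apply, map_sum, map_smul, rep_sum _ _ hw, rep_smul _ _ hw]

theorem quotOp_shift_sub (f : Polynomial ℂ) (a : ℂ) (v : BergmanSpace) :
    quotOp f a (shift v - a • v) =
      toeplitz (isHInfty_polynomial f).symbol v - f.eval a • v := by
  refine ext_rep fun z hz => ?_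
  have h := rep_map_quotOp f (ContinuousLinearMap.id ℂ _) a (shift v - a • v) hz
  simp only [ContinuousLinearMap.id_apply] at h
  rw [h, rep_sub _ _ hz, rep_toeplitz _ _ hz, rep_smul _ _ hz, Polynomial.eval_eq_sum_range,
    Polynomial.eval_eq_sum_range, ← sub_mul, ← Finset.sum_sub_distrib, Finset.sum_mul]
  refine Finset.sum_congr rfl fun n _ => ?_
  rw [← mul_sub, ← geom_sum₂_mul, Finset.sum_mul, Finset.mul_sum, Finset.sum_mul]
  refine Finset.sum_congr rfl fun i _ => ?_
  rw [rep_shift_pow _ _ hz, rep_sub _ _ hz, rep_smul _ _ hz, rep_shift _ hz]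
  ring

theorem exists_norm_quotOp_le (f : Polynomial ℂ) : ∃ C, ∀ a ∈ disk, ‖quotOp f a‖ ≤ C := by
  have hc : Continuous (quotOp f) := by
    unfold quotOp
    fun_prop
  obtain ⟨C, hC⟩ := (isCompact_closedBall (0 : ℂ) 1).exists_bound_of_continuousOn hc.continuousOn
  exact ⟨C, fun a ha => hC a (Metric.ball_subset_closedBall ha)⟩

theorem isHInfty_inv_sub {a : ℂ} (ha : 1 < ‖a‖) : IsHInfty fun z => (z - a)⁻¹ := by
  have hb : ∀ z ∈ disk, ‖a‖ - 1 ≤ ‖z - a‖ := fun z hz => by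
    have h1 := mem_ball_zero_iff.1 hz
    have h2 := norm_sub_norm_le a z
    rw [norm_sub_rev] at h2
    linarith
  refine ⟨DifferentiableOn.inv (by fun_prop) fun z hz => ?_, (‖a‖ - 1)⁻¹, fun z hz => ?_⟩
  · exact norm_pos_iff.1 ((sub_pos.2 ha).trans_le (hb z hz))
  · rw [norm_inv]
    exact inv_anti₀ (sub_pos.2 ha) (hb z hz)

section Commutant

variable {f : Polynomial ℂ} {K : BergmanSpace →L[ℂ] BergmanSpace}
  (hK : Commute K (toeplitz (isHInfty_polynomial f).symbol))
include hK

/-- The argument of `K` is `(T_f - f(a)) v`; moving `T_f` past `K` and evaluating at `w` leaves the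
factor `f(w) - f(a) = 0`. -/
theorem rep_map_quotOp_eq_zero {a w : ℂ} (hw : w ∈ disk) (haw : f.eval a = f.eval w)
    (v : BergmanSpace) : rep (K (quotOp f a (shift v - a • v))) w = 0 := by
  have h : K (toeplitz (isHInfty_polynomial f).symbol v) =
      toeplitz (isHInfty_polynomial f).symbol (K v) :=
    congrArg (fun T : BergmanSpace →L[ℂ] BergmanSpace => T v) hK.eq
  rw [quotOp_shift_sub, map_sub, map_smul, h, rep_sub _ _ hw, rep_toeplitz _ _ hw,
    rep_smul _ _ hw, haw, sub_self]

/-- For `a` outside the closed disk, `z - a` is invertible in `H^∞`, so every `u` is a multiple of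
it. -/
theorem rep_map_quotOp_eq_zero_of_one_lt {a w : ℂ} (hw : w ∈ disk) (haw : f.eval a = f.eval w)
    (ha : 1 < ‖a‖) (u : BergmanSpace) : rep (K (quotOp f a u)) w = 0 := by
  have h : u = shift (toeplitz (isHInfty_inv_sub ha).symbol u) -
      a • toeplitz (isHInfty_inv_sub ha).symbol u := by
    refine ext_rep fun z hz => ?_
    rw [rep_sub _ _ hz, rep_shift _ hz, rep_smul _ _ hz, rep_toeplitz _ _ hz, ← sub_mul,
      ← mul_assoc, mul_inv_cancel₀, one_mul]
    rw [sub_ne_zero]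
    rintro rfl
    exact absurd (mem_ball_zero_iff.1 hz) (not_lt.2 ha.le)
  rw [h]
  exact rep_map_quotOp_eq_zero hK hw haw _

/-- The multiples of `z - a` have codimension one: `u - u(a)` is always one of them. -/
theorem rep_map_quotOp_eq_mul {a w : ℂ} (hw : w ∈ disk) (haw : f.eval a = f.eval w)
    (ha : a ∈ disk) (u : BergmanSpace) :
    rep (K (quotOp f a u)) w = rep u a * rep (K (quotOp f a one)) w := by
  have h := rep_map_quotOp_eq_zero hK hw haw (quot u ha)
  rw [shift_sub_quot, map_sub, map_sub, map_smul, map_smul, rep_sub _ _ hw, rep_smul _ _ hw] at h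
  exact sub_eq_zero.1 h

/-- Evaluate the rank-one formula at `peak ha` and move `K` to the kernel at `w`. -/
theorem norm_rep_map_quotOp_one_le {a w : ℂ} (hw : w ∈ disk) (haw : f.eval a = f.eval w)
    (ha : a ∈ disk) {C : ℝ} (hC : ‖quotOp f a‖ ≤ C) :
    (1 - ‖w‖) * ‖rep (K (quotOp f a one)) w‖ ≤
      (1 - ‖a‖ ^ 2) * (C * ‖ContinuousLinearMap.adjoint K (kernel hw)‖) := by
  have hw1 := mem_ball_zero_iff.1 hw
  have ha1 := mem_ball_zero_iff.1 ha
  have h1 : (1 - ‖w‖) * ‖rep (K (quotOp f a (peak ha))) w‖ ≤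
      C * ‖ContinuousLinearMap.adjoint K (kernel hw)‖ := by
    have h2 : ‖inner ℂ (kernel hw) (K (quotOp f a (peak ha)))‖ =
        (1 - ‖w‖) * ‖rep (K (quotOp f a (peak ha))) w‖ := by
      rw [inner_kernel, norm_mul, Complex.norm_real, Real.norm_of_nonneg (by linarith)]
    rw [← h2, ← ContinuousLinearMap.adjoint_inner_left, mul_comm]
    refine (norm_inner_le_norm _ _).trans ?_
    gcongr
    exact ((quotOp f a).le_of_opNorm_le_of_le hC (norm_peak_le ha)).trans_eq (mul_one C)
  rw [rep_map_quotOp_eq_mul hK hw haw ha, norm_mul] at h1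
  have ha2 : 0 ≤ 1 - ‖a‖ ^ 2 := by nlinarith [norm_nonneg a]
  calc (1 - ‖w‖) * ‖rep (K (quotOp f a one)) w‖
      = ((1 - ‖a‖ ^ 2) * ‖rep (peak ha) a‖) * ((1 - ‖w‖) * ‖rep (K (quotOp f a one)) w‖) := by
        rw [norm_rep_peak, one_mul]
    _ = (1 - ‖a‖ ^ 2) *
        ((1 - ‖w‖) * (‖rep (peak ha) a‖ * ‖rep (K (quotOp f a one)) w‖)) := by ring
    _ ≤ _ := by gcongr

end Commutant

/-- The expanded divided difference is a finite sum of powers of `σ w` times fixed holomorphic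
functions of `w`. -/
theorem differentiableOn_rep_map_quotOp (f : Polynomial ℂ) (K : BergmanSpace →L[ℂ] BergmanSpace)
    (u : BergmanSpace) {σ : ℂ → ℂ} {V : Set ℂ} (hV : V ⊆ disk) (hσ : DifferentiableOn ℂ σ V) :
    DifferentiableOn ℂ (fun w => rep (K (quotOp f (σ w) u)) w) V := by
  refine DifferentiableOn.congr (f := fun w => ∑ n ∈ Finset.range (f.natDegree + 1),
    ∑ i ∈ Finset.range n, f.coeff n * σ w ^ (n - 1 - i) * rep (K ((shift ^ i) u)) w) ?_
    fun w hw => rep_map_quotOp f K (σ w) u (hV hw)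
  refine DifferentiableOn.fun_sum fun n _ => DifferentiableOn.fun_sum fun i _ => ?_
  exact ((hσ.pow _).const_mul _).mul ((differentiableOn_rep _).mono hV)

/-- The divided difference of a polynomial of degree `N` determines the value of a linear functional
at one from its values at `N` points. -/
theorem eq_zero_of_divided_difference {f : Polynomial ℂ} (hf : f.natDegree ≠ 0) (b : ℕ → ℂ)
    (s : Finset ℂ) (hs : s.card = f.natDegree)
    (h : ∀ a ∈ s, ∑ n ∈ Finset.range (f.natDegree + 1), ∑ i ∈ Finset.range n,
      f.coeff n * a ^ (n - 1 - i) * b i = 0) : b 0 = 0 := by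
  set Q : Polynomial ℂ := ∑ n ∈ Finset.range (f.natDegree + 1), ∑ i ∈ Finset.range n,
    Polynomial.C (f.coeff n * b i) * Polynomial.X ^ (n - 1 - i) with hQ
  have hdeg : Q.degree < f.natDegree := by
    refine (Polynomial.degree_lt_iff_coeff_zero _ _).2 fun m hm => ?_
    rw [hQ, Polynomial.finsetSum_coeff]
    refine Finset.sum_eq_zero fun n hn => ?_
    rw [Polynomial.finsetSum_coeff]
    refine Finset.sum_eq_zero fun i hi => ?_
    rw [Polynomial.coeff_C_mul_X_pow, if_neg]
    rw [Finset.mem_range] at hn hi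
    omega
  have hQ0 : Q = 0 := by
    refine Polynomial.eq_zero_of_degree_lt_of_eval_finset_eq_zero s (by rwa [hs]) fun a ha => ?_
    rw [← h a ha, hQ]
    simp only [Polynomial.eval_finsetSum, Polynomial.eval_mul, Polynomial.eval_C,
      Polynomial.eval_pow, Polynomial.eval_X]
    refine Finset.sum_congr rfl fun n _ => Finset.sum_congr rfl fun i _ => ?_
    ring
  -- The top power of the variable arises only from `n = f.natDegree`, `i = 0`.
  have hcoeff : Q.coeff (f.natDegree - 1) = f.coeff f.natDegree * b 0 := by
    rw [hQ, Polynomial.finsetSum_coeff, Finset.sum_eq_single f.natDegree]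
    · rw [Polynomial.finsetSum_coeff, Finset.sum_eq_single 0]
      · rw [Polynomial.coeff_C_mul_X_pow, if_pos (by omega)]
      · intro i hi hi0
        rw [Polynomial.coeff_C_mul_X_pow, if_neg]
        rw [Finset.mem_range] at hi
        omega
      · intro h0
        simp only [Finset.mem_range, not_lt] at h0
        omega
    · intro n hn hne
      rw [Polynomial.finsetSum_coeff]
      refine Finset.sum_eq_zero fun i hi => ?_
      rw [Polynomial.coeff_C_mul_X_pow, if_neg]
      rw [Finset.mem_range] at hn hi
      omega
    · intro h0
      simp at h0
  rw [hQ0, Polynomial.coeff_zero, zero_eq_mul] at hcoeff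
  refine hcoeff.resolve_left fun h0 => hf ?_
  rw [Polynomial.coeff_natDegree, Polynomial.leadingCoeff_eq_zero] at h0
  simp [h0]

/-! ### Vanishing of operators with compact adjoint that commute with `T_f`. -/

section Compact

variable {f : Polynomial ℂ} {K : BergmanSpace →L[ℂ] BergmanSpace}

/-- If the maximum modulus one were attained, `σ` would be locally constant, and so would `f`. -/
theorem norm_lt_one_of_norm_le_one (hf : f.natDegree ≠ 0) {σ : ℂ → ℂ} {V : Set ℂ} (hV : IsOpen V)
    (hσ : DifferentiableOn ℂ σ V) (hfσ : ∀ w ∈ V, f.eval (σ w) = f.eval w)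
    (hle : ∀ w ∈ V, ‖σ w‖ ≤ 1) : ∀ w ∈ V, ‖σ w‖ < 1 := by
  intro w hw
  refine lt_of_le_of_ne (hle w hw) fun heq => ?_
  have hVw := hV.mem_nhds hw
  have hmax : IsLocalMax (norm ∘ σ) w := by
    filter_upwards [hVw] with z hz
    simp only [Function.comp_apply, heq]
    exact hle z hz
  have h := Complex.eventually_eq_of_isLocalMax_norm
    (by filter_upwards [hVw] with z hz using hσ.differentiableAt (hV.mem_nhds hz)) hmax
  have h2 : {z : ℂ | f.eval z = f.eval w} ∈ 𝓝 w := by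
    filter_upwards [h, hVw] with z hz hzV
    rw [← hfσ z hzV, hz, hfσ w hw]
  exact infinite_of_mem_nhds w h2 (finite_setOf_eval_eq hf _)

theorem mem_closure_ball_inter_disk {w₀ w : ℂ} {ε : ℝ} (hw : w ∈ Metric.ball w₀ ε) (hw1 : ‖w‖ ≤ 1) :
    w ∈ closure (Metric.ball w₀ ε ∩ disk) := by
  refine Metric.isOpen_ball.inter_closure ⟨hw, ?_⟩
  rw [closure_ball _ one_ne_zero]
  exact mem_closedBall_zero_iff.2 hw1

/-- A branch of `f⁻¹ ∘ f` that stays in the disk near a boundary point over the boundary of the image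
of the disk is nontangential up to a constant. -/
theorem exists_one_sub_norm_branch_le {w₀ : ℂ} (hw₀ : ‖w₀‖ = 1)
    (hfreq : ∃ᶠ w in 𝓝[≠] w₀, ‖w‖ = 1 ∧ f.eval w ∉ f.eval '' disk) {σ : ℂ → ℂ} {ε : ℝ}
    (hε : 0 < ε) (hσ : DifferentiableOn ℂ σ (Metric.ball w₀ ε))
    (hfσ : ∀ w ∈ Metric.ball w₀ ε, f.eval (σ w) = f.eval w)
    (hle : ∀ w ∈ Metric.ball w₀ ε ∩ disk, ‖σ w‖ ≤ 1) :
    ∃ C, 0 ≤ C ∧ ∀ᶠ w in 𝓝 w₀, ‖w‖ ≤ 1 → 1 - ‖σ w‖ ≤ C * (1 - ‖w‖) := by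
  have hmem := Metric.ball_mem_nhds w₀ hε
  -- At such a point `‖σ w‖ ≤ 1` by continuity from inside the disk, and `‖σ w‖ < 1` would place
  -- `f(w) = f(σ w)` in the image of the disk.
  have hfr : ∃ᶠ w in 𝓝[≠] w₀, ‖w‖ = 1 ∧ ‖σ w‖ = 1 := by
    refine (hfreq.and_eventually (nhdsWithin_le_nhds hmem)).mono ?_
    rintro w ⟨⟨hw1, hwf⟩, hwb⟩
    refine ⟨hw1, le_antisymm ?_ ?_⟩
    · have hc : ContinuousWithinAt σ (Metric.ball w₀ ε ∩ disk) w :=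
        ((hσ.differentiableAt (Metric.isOpen_ball.mem_nhds hwb)).continuousAt).continuousWithinAt
      have := hc.mem_closure (mem_closure_ball_inter_disk hwb hw1.le)
        (t := Metric.closedBall 0 1) fun z hz => mem_closedBall_zero_iff.2 (hle z hz)
      rw [Metric.isClosed_closedBall.closure_eq] at this
      exact mem_closedBall_zero_iff.1 this
    · by_contra! hlt
      exact hwf ⟨σ w, mem_ball_zero_iff.2 hlt, hfσ w hwb⟩
  have han : AnalyticAt ℂ σ w₀ := hσ.analyticAt hmem
  exact exists_one_sub_norm_le hw₀ han (eventually_norm_eq_one_of_frequently hw₀ han hfr)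

/-- An operator with compact adjoint that commutes with `T_f` does not see a branch of `f⁻¹ ∘ f` at
a boundary point over the boundary of the image of the disk. -/
theorem eventually_rep_map_quotOp_eq_zero (hf : f.natDegree ≠ 0)
    (hK : Commute K (toeplitz (isHInfty_polynomial f).symbol))
    (hKc : IsCompactOperator (ContinuousLinearMap.adjoint K)) {w₀ : ℂ} (hw₀ : ‖w₀‖ = 1)
    (hfreq : ∃ᶠ w in 𝓝[≠] w₀, ‖w‖ = 1 ∧ f.eval w ∉ f.eval '' disk) {σ : ℂ → ℂ}
    (hσ : AnalyticAt ℂ σ w₀) (hfσ : ∀ᶠ w in 𝓝 w₀, f.eval (σ w) = f.eval w) (u : BergmanSpace) :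
    ∀ᶠ w in 𝓝 w₀, w ∈ disk → rep (K (quotOp f (σ w) u)) w = 0 := by
  obtain ⟨ε, hε, hball⟩ := Metric.eventually_nhds_iff_ball.1 (hσ.eventually_analyticAt.and hfσ)
  have hd : DifferentiableOn ℂ σ (Metric.ball w₀ ε) := fun w hw =>
    (hball w hw).1.differentiableAt.differentiableWithinAt
  have hfb : ∀ w ∈ Metric.ball w₀ ε, f.eval (σ w) = f.eval w := fun w hw => (hball w hw).2
  by_cases hcase : ∃ w ∈ Metric.ball w₀ ε ∩ disk, 1 < ‖σ w‖
  · obtain ⟨w₁, hw₁, h1⟩ := hcase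
    have hG := differentiableOn_rep_map_quotOp f K u (V := Metric.ball w₀ ε ∩ disk)
      Set.inter_subset_right (hd.mono Set.inter_subset_left)
    have hev : (fun w => rep (K (quotOp f (σ w) u)) w) =ᶠ[𝓝 w₁] 0 := by
      have hcont : ContinuousAt σ w₁ := (hball w₁ hw₁.1).1.continuousAt
      filter_upwards [hcont.norm.eventually (lt_mem_nhds h1),
        (isOpen_ball_inter_disk w₀ ε).mem_nhds hw₁] with w hw hwb
      exact rep_map_quotOp_eq_zero_of_one_lt hK hwb.2 (hfb w hwb.1) hw u
    have hz := (hG.analyticOnNhd (isOpen_ball_inter_disk _ _)).eqOn_zero_of_preconnected_of_eventuallyEq_zero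
      (isPreconnected_ball_inter_disk _ _) hw₁ hev
    filter_upwards [Metric.ball_mem_nhds w₀ hε] with w hw hwd
    exact hz ⟨hw, hwd⟩
  · push Not at hcase
    have hlt := norm_lt_one_of_norm_le_one hf (isOpen_ball_inter_disk w₀ ε)
      (hd.mono Set.inter_subset_left) (fun w hw => hfb w hw.1) hcase
    obtain ⟨C, hC0, hC⟩ := exists_one_sub_norm_branch_le hw₀ hfreq hε hd hfb hcase
    obtain ⟨C', hC'⟩ := exists_norm_quotOp_le f
    have hC'0 : 0 ≤ C' := (norm_nonneg _).trans (hC' 0 zero_mem_disk)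
    obtain ⟨δ, hδ, hδb⟩ := Metric.eventually_nhds_iff_ball.1
      (hC.and (Metric.ball_mem_nhds w₀ hε))
    have hest : ∀ w (hw : w ∈ Metric.ball w₀ δ ∩ disk), ‖rep (K (quotOp f (σ w) one)) w‖ ≤
        2 * C * C' * ‖ContinuousLinearMap.adjoint K (kernel hw.2)‖ := by
      intro w hw
      have hwε : w ∈ Metric.ball w₀ ε ∩ disk := ⟨(hδb w hw.1).2, hw.2⟩
      have hw1 := mem_ball_zero_iff.1 hw.2
      have hs1 := hlt w hwε
      have h1 := norm_rep_map_quotOp_one_le hK hw.2 (hfb w hwε.1) (mem_ball_zero_iff.2 hs1)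
        (hC' _ (mem_ball_zero_iff.2 hs1))
      have h2 := (hδb w hw.1).1 hw1.le
      -- This cancels the factor `1 - ‖w‖` in the kernel estimate, leaving only the norm that
      -- compactness sends to zero.
      have h3 : 1 - ‖σ w‖ ^ 2 ≤ 2 * (C * (1 - ‖w‖)) := by nlinarith [norm_nonneg (σ w)]
      have h4 : (1 - ‖w‖) * ‖rep (K (quotOp f (σ w) one)) w‖ ≤
          (1 - ‖w‖) * (2 * C * C' * ‖ContinuousLinearMap.adjoint K (kernel hw.2)‖) := by
        refine h1.trans ((mul_le_mul_of_nonneg_right h3 (by positivity)).trans_eq ?_)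
        ring
      exact le_of_mul_le_mul_left h4 (by linarith)
    have hG := differentiableOn_rep_map_quotOp f K one (V := Metric.ball w₀ δ ∩ disk)
      Set.inter_subset_right (hd.mono fun w hw => (hδb w hw.1).2)
    have hz := eqOn_zero_of_boundary hw₀ hδ hG
      (M := 2 * C * C' * (‖ContinuousLinearMap.adjoint K‖ * 1)) (fun w hw => ?_) fun η hη => ?_
    · filter_upwards [Metric.ball_mem_nhds w₀ hδ] with w hw hwd
      have hwε : w ∈ Metric.ball w₀ ε ∩ disk := ⟨(hδb w hw).2, hwd⟩
      have h0 : rep (K (quotOp f (σ w) one)) w = 0 := hz ⟨hw, hwd⟩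
      rw [rep_map_quotOp_eq_mul hK hwd (hfb w hwε.1) (mem_ball_zero_iff.2 (hlt w hwε)), h0,
        mul_zero]
    · refine (hest w hw).trans ?_
      gcongr
      exact (ContinuousLinearMap.adjoint K).le_of_opNorm_le_of_le le_rfl (norm_kernel_le hw.2)
    · obtain ⟨ρ, hρ1, hρ⟩ := exists_norm_compact_kernel_le hKc
        (ε := η / (2 * C * C' + 1)) (by positivity)
      refine ⟨ρ, hρ1, fun w hw hρw => (hest w hw).trans ?_⟩
      calc 2 * C * C' * ‖ContinuousLinearMap.adjoint K (kernel hw.2)‖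
          ≤ 2 * C * C' * (η / (2 * C * C' + 1)) := by
            gcongr
            exact hρ w hw.2 hρw
        _ ≤ η := by
            rw [mul_div_assoc', div_le_iff₀ (by positivity)]
            nlinarith

/-- An operator with compact adjoint that commutes with a Toeplitz operator with nonconstant
polynomial symbol is zero. -/
theorem eq_zero_of_isCompactOperator_adjoint (hf : f.natDegree ≠ 0)
    (hK : Commute K (toeplitz (isHInfty_polynomial f).symbol))
    (hKc : IsCompactOperator (ContinuousLinearMap.adjoint K)) : K = 0 := by
  classical
  obtain ⟨w₀, hw₀, hreg, hfreq⟩ := exists_regular_accumulation hf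
  set s := (f - Polynomial.C (f.eval w₀)).roots.toFinset with hs
  have hcard : s.card = f.natDegree := card_roots_toFinset_of_regular hreg
  have hroot : ∀ a ∈ s, f.eval a = f.eval w₀ := fun a ha => by
    rw [hs, Multiset.mem_toFinset] at ha
    have := Polynomial.isRoot_of_mem_roots ha
    simpa [sub_eq_zero] using this
  have hbr : ∀ a ∈ s, ∃ σ : ℂ → ℂ, AnalyticAt ℂ σ w₀ ∧ σ w₀ = a ∧
      ∀ᶠ w in 𝓝 w₀, f.eval (σ w) = f.eval w := fun a ha =>
    exists_analytic_branch (hroot a ha) (hreg a (hroot a ha))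
  choose! σ hσ hσ0 hfσ using hbr
  have hinj : ∀ᶠ w in 𝓝 w₀, ∀ a ∈ s, ∀ b ∈ s, a ≠ b → σ a w ≠ σ b w := by
    refine (Finset.eventually_all s).2 fun a ha => (Finset.eventually_all s).2 fun b hb => ?_
    by_cases hab : a = b
    · simp [hab]
    · have h1 : σ a w₀ ≠ σ b w₀ := by rwa [hσ0 a ha, hσ0 b hb]
      filter_upwards [((hσ a ha).continuousAt.sub (hσ b hb).continuousAt).eventually_ne
        (sub_ne_zero.2 h1)] with w hw _ using sub_ne_zero.1 hw
  refine ContinuousLinearMap.ext fun u => ext_rep ?_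
  have hloc : ∀ᶠ w in 𝓝 w₀, w ∈ disk → rep (K u) w = 0 := by
    have hall : ∀ᶠ w in 𝓝 w₀, ∀ a ∈ s, w ∈ disk → rep (K (quotOp f (σ a w) u)) w = 0 :=
      (Finset.eventually_all s).2 fun a ha =>
        eventually_rep_map_quotOp_eq_zero hf hK hKc hw₀ hfreq (hσ a ha) (hfσ a ha) u
    filter_upwards [hall, hinj] with w hw hwi hwd
    -- For fixed `w` the branch values are `f.natDegree` distinct zeros of a polynomial of smaller
    -- degree.
    have h := eq_zero_of_divided_difference hf (fun i => rep (K ((shift ^ i) u)) w)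
      (s.image fun a => σ a w) ?_ ?_
    · simpa using h
    · rw [Finset.card_image_of_injOn, hcard]
      intro a ha b hb hab
      by_contra hne
      exact hwi a ha b hb hne hab
    · intro b hb
      obtain ⟨a, ha, rfl⟩ := Finset.mem_image.1 hb
      rw [← rep_map_quotOp f K (σ a w) u hwd]
      exact hw a ha hwd
  obtain ⟨ε, hε, hball⟩ := Metric.eventually_nhds_iff_ball.1 hloc
  obtain ⟨w₁, hw₁⟩ : (Metric.ball w₀ ε ∩ disk).Nonempty := closure_nonempty_iff.1
    ⟨w₀, mem_closure_ball_inter_disk (Metric.mem_ball_self hε) hw₀.le⟩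
  have hz := ((differentiableOn_rep (K u)).analyticOnNhd
    Metric.isOpen_ball).eqOn_zero_of_preconnected_of_eventuallyEq_zero
    (convex_ball (0 : ℂ) 1).isPreconnected hw₁.2 (by
      filter_upwards [(isOpen_ball_inter_disk w₀ ε).mem_nhds hw₁] with w hw
      exact hball w hw.1 hw.2)
  intro z hz1
  rw [hz hz1, zero_apply, rep_zero hz1]
  rfl

end Compact

/-! ### The commutant of the shift, and the conclusion. -/

theorem commute_shift_toeplitz {g : ℂ → ℂ} (hg : IsHInfty g) :
    Commute shift (toeplitz hg.symbol) := by
  refine ContinuousLinearMap.ext fun u => ext_rep fun z hz => ?_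
  rw [mul_apply_eq_comp, mul_apply_eq_comp, rep_shift _ hz, rep_toeplitz _ _ hz,
    rep_toeplitz _ _ hz, rep_shift _ hz]
  ring

/-- An operator commuting with the shift is a Toeplitz operator with bounded holomorphic symbol. -/
theorem exists_eq_toeplitz_of_commute_shift {S : BergmanSpace →L[ℂ] BergmanSpace}
    (hS : Commute S shift) : ∃ (g : ℂ → ℂ) (hg : IsHInfty g), S = toeplitz hg.symbol := by
  have hmul : ∀ u, ∀ w ∈ disk, rep (S u) w = rep (S one) w * rep u w := by
    intro u w hw
    have h1 : S (shift (quot u hw)) = shift (S (quot u hw)) :=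
      congrArg (fun T : BergmanSpace →L[ℂ] BergmanSpace => T (quot u hw)) hS.eq
    -- Since `u - u(w)` is `z - w` times a Bergman function, so is its image under `S`, which
    -- therefore vanishes at `w`.
    have h2 := congrArg (fun v => rep (S v) w) (shift_sub_quot u hw)
    simp only [map_sub, map_smul, h1] at h2
    rw [rep_sub _ _ hw, rep_sub _ _ hw, rep_shift _ hw, rep_smul _ _ hw, rep_smul _ _ hw, sub_self,
      eq_comm, sub_eq_zero] at h2
    rw [h2, mul_comm]
  have hg : IsHInfty (rep (S one)) := by
    refine ⟨differentiableOn_rep _, 2 * ‖S‖, fun w hw => ?_⟩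
    have hw1 := mem_ball_zero_iff.1 hw
    have h1 := (one_sub_norm_mul_norm_rep_le (S (peak hw)) hw).trans
      (S.le_of_opNorm_le_of_le le_rfl (norm_peak_le hw))
    rw [hmul _ _ hw, norm_mul, mul_one] at h1
    have h2 := norm_rep_peak hw
    calc ‖rep (S one) w‖
        = ((1 - ‖w‖ ^ 2) * ‖rep (peak hw) w‖) * ‖rep (S one) w‖ := by rw [h2, one_mul]
      _ = (1 + ‖w‖) * ((1 - ‖w‖) * (‖rep (S one) w‖ * ‖rep (peak hw) w‖)) := by ring
      _ ≤ (1 + ‖w‖) * ‖S‖ := by gcongr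
      _ ≤ 2 * ‖S‖ := by
        gcongr
        linarith
  refine ⟨_, hg, ContinuousLinearMap.ext fun u => ext_rep fun z hz => ?_⟩
  rw [rep_toeplitz _ _ hz, hmul u z hz]

end Bergman

end

theorem corollary2 (f : Polynomial ℂ) (hf : f.natDegree ≠ 0)
    (S : Bergman.BergmanSpace →L[ℂ] Bergman.BergmanSpace)
    (hS : S ∈ Bergman.toeplitzAlgebra)
    (hcomm : Commute S (Bergman.toeplitz (Bergman.isHInfty_polynomial f).symbol)) :
    ∃ (g : ℂ → ℂ) (hg : Bergman.IsHInfty g), S = Bergman.toeplitz hg.symbol := by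
  have hshift := Bergman.commute_shift_toeplitz (Bergman.isHInfty_polynomial f)
  have hK : Commute (S * Bergman.shift - Bergman.shift * S)
      (Bergman.toeplitz (Bergman.isHInfty_polynomial f).symbol) :=
    (hcomm.mul_left hshift).sub_left (hshift.mul_left hcomm)
  -- The compactness result concerns commutators with `star shift`; applied to `star S` it gives
  -- compactness of the adjoint of `K`.
  have hKc : IsCompactOperator
      (ContinuousLinearMap.adjoint (S * Bergman.shift - Bergman.shift * S)) := by
    refine Bergman.isCompactOperator_of_eq
      (Bergman.isCompactOperator_commutator_of_mem_toeplitzAlgebra (star_mem hS)) ?_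
    rw [← ContinuousLinearMap.star_eq_adjoint, star_sub, star_mul, star_mul]
  exact Bergman.exists_eq_toeplitz_of_commute_shift
    (sub_eq_zero.1 (Bergman.eq_zero_of_isCompactOperator_adjoint hf hK hKc))
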